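/- Let $\mathcal G=(\mathcal V,\mathcal E)$ be a finite directed network, parallel edges allowed, with three distinct nodes: a source $S$, a terminal $T$ and a key-generating node $K$. Every edge carries one symbol of a finite alphabet $A$ with at least two elements (for linear codes $A=\mathbb F_q$). Let $R>0$ and $z\ge 0$ be integers. The source holds a message $M$ uniformly distributed on $A^R$, and $K$ holds a key $N$, independent of $M$ and uniformly distributed on some finite nonempty set of arbitrary size ($\mathbb F_q^{k}$ with $k$ arbitrary for linear codes); no other randomness is available. If $\mathcal G$ is acyclic, a code assigns to each edge $e=(u,v)$ a symbol $X_e$ that is a function of the symbols on the incoming edges of $u$, of $M$ as well if $u=S$, and of $N$ as well if $u=K$. The code is $(R,z)$-feasible if $T$ can recover $M$ with zero error from the symbols on its incoming edges and $I(M;X_{\mathcal W})=0$ for every set $\mathcal W\subseteq\mathcal E$ of at most $z$ edges, where $X_{\mathcal W}=(X_e)_{e\in\mathcal W}$. It is scalar linear if $A$ is a finite field $\mathbb F_q$ and all encoding functions and the decoding function are linear over it. For a set of nodes $\mathcal A\not\ni T'$, a cut is a set of edges whose removal disconnects all directed paths from nodes of $\mathcal A$ to $T'$, and its value is its number of edges.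 Let $C_{K-S}$, $C_{K-T}$, $C_{S-T}$ and $C_{KS-T}$ be the minimum values of cuts separating $K$ from $S$, $K$ from $T$, $S$ from $T$, and $\{K,S\}$ from $T$. Consider the conditions $$z\le\min(C_{K-S},C_{K-T}),\qquad R\le C_{S-T},\qquad R+z\le C_{KS-T}.\qquad(*)$$ 1. If $\mathcal G$ is acyclic, then an $(R,z)$-feasible scalar linear code over some finite field exists if and only if $(*)$ holds, and an $(R,z)$-feasible (arbitrary, possibly nonlinear) code over some finite alphabet exists if and only if $(*)$ holds. 2. If $\mathcal G$ is acyclic and $(*)$ holds, there is a constant $C$, depending only on $\mathcal G$, $R$ and $z$, such that for every finite field $\mathbb F_q$ the scalar linear code with $z$ key symbols whose encoding coefficients are independent and uniform over $\mathbb F_q$ is $(R,z)$-feasible with probability at least $1-C/q$. In particular, scalar linear $(R,z)$-feasible codes exist over every sufficiently large finite field. 3. The condition $(*)$ is also necessary if $\mathcal G$ may contain cycles and codes are time-indexed: if, for some $n\ge1$, the message $M$ is uniform on $A^{nR}$, the symbol $X_e^{(i)}\in A$ on $e=(u,v)$ at each time $i\in\{1,\dots,n\}$ is a function of the symbols on the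 incoming edges of $u$ at times $j<i$, of $M$ as well if $u=S$, and of $N$ as well if $u=K$, the terminal $T$ recovers $M$ with zero error from what its incoming edges carry during the $n$ time steps, and $I(M;(X_e^{(i)})_{e\in\mathcal W,\,1\le i\le n})=0$ for every set $\mathcal W$ of at most $z$ edges, then $(*)$ holds. -/

import Mathlib

/-! ### Shannon information on a finite uniform probability space -/

/-- `Pr[X = a]` for `ω` uniform on the finite set `Ω`. -/
noncomputable def unifProb {Ω α : Type*} (X : Ω → α) (a : α) : ℝ :=
  (Nat.card {ω : Ω // X ω = a} : ℝ) / (Nat.card Ω : ℝ)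

/-- The Shannon entropy `H(X)` (in nats), with `Real.negMulLog p = -p log p`. -/
noncomputable def shannonEntropy {Ω α : Type*} [Fintype α] (X : Ω → α) : ℝ :=
  ∑ a : α, Real.negMulLog (unifProb X a)

/-- The mutual information `I(X;Y) = H(X) + H(Y) - H(X,Y)`. -/
noncomputable def mutualInfo {Ω α β : Type*} [Fintype α] [Fintype β]
    (X : Ω → α) (Y : Ω → β) : ℝ :=
  shannonEntropy X + shannonEntropy Y - shannonEntropy (fun ω => (X ω, Y ω))

/-! ### Networks and cuts -/

/-- A directed multigraph with node type `V` and type `E` of unit-capacity edges, together with a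
source `S`, a terminal `T` and a key-generating node `K`. -/
structure Network (V E : Type*) where
  tail : E → V
  head : E → V
  S : V
  T : V
  K : V

namespace Network

variable {V E : Type*}

/-- The incoming edges of a node. -/
abbrev In (G : Network V E) (u : V) : Type _ := {e : E // G.head e = u}

/-- There is an edge from `u` to `v` which does not belong to `C`. -/
def StepAvoiding (G : Network V E) (C : Finset E) (u v : V) : Prop :=
  ∃ e : E, e ∉ C ∧ G.tail e = u ∧ G.head e = v

/-- No node lies on a directed cycle. -/
def IsAcyclic (G : Network V E) : Prop :=
  ∀ v : V, ¬ Relation.TransGen (G.StepAvoiding ∅) v v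

/-- Removing the edges in `C` disconnects all paths from nodes of `A` to `t`. -/
def IsCut (G : Network V E) (A : Set V) (t : V) (C : Finset E) : Prop :=
  ∀ s ∈ A, ¬ Relation.ReflTransGen (G.StepAvoiding C) s t

/-- The least number of edges in a cut separating `A` from `t` (a cut exists when `t ∉ A`). -/
noncomputable def mincut (G : Network V E) (A : Set V) (t : V) : ℕ :=
  sInf {c : ℕ | ∃ C : Finset E, G.IsCut A t C ∧ C.card = c}

/-- The three cut-set conditions. -/
def CutBounds (G : Network V E) (R z : ℕ) : Prop :=
  z ≤ min (G.mincut {G.K} G.S) (G.mincut {G.K} G.T) ∧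
  R ≤ G.mincut {G.S} G.T ∧
  R + z ≤ G.mincut {G.K, G.S} G.T

/-! ### Decodability and security -/

/-- `z`-security of edge messages `X` (functions of the uniformly distributed pair of message and
key): `I(M; X_W) = 0` for every set `W` of at most `z` edges. -/
def Secure [DecidableEq E] {Msg Key B : Type*} [Fintype Msg] [Fintype B]
    (z : ℕ) (X : E → Msg × Key → B) : Prop :=
  ∀ W : Finset E, W.card ≤ z →
    mutualInfo (fun ω : Msg × Key => ω.1) (fun (ω : Msg × Key) (e : {e : E // e ∈ W}) => X e ω) = 0

/-- The terminal recovers the message without error from its incoming edges. -/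
def Decodable (G : Network V E) {Msg Key B : Type*} (X : E → Msg × Key → B) : Prop :=
  ∃ g : (G.In G.T → B) → Msg, ∀ ω : Msg × Key, g (fun e => X e ω) = ω.1

/-! ### Codes on acyclic networks -/

/-- Local encoding functions: the message on `e` is a function of the messages on the incoming edges
of the tail of `e`, of the source message if this tail is `S`, and of the key if it is `K`. -/
abbrev Encoding (G : Network V E) (Msg Key A : Type*) : Type _ :=
  ∀ e : E, (G.In (G.tail e) → A) → (G.tail e = G.S → Msg) → (G.tail e = G.K → Key) → A

theorem IsAcyclic.wellFounded [Finite E] {G : Network V E} (hG : G.IsAcyclic) :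
    WellFounded (fun e' e : E => G.head e' = G.tail e) := by
  have key : ∀ a b : E, Relation.TransGen (fun e' e : E => G.head e' = G.tail e) a b →
      Relation.TransGen (G.StepAvoiding ∅) (G.tail a) (G.tail b) := by
    intro a b h
    induction h with
    | single h => exact .single ⟨a, by simp, rfl, h⟩
    | @tail b c _ h ih => exact ih.tail ⟨b, by simp, rfl, h⟩
  have irr : Std.Irrefl (Relation.TransGen (fun e' e : E => G.head e' = G.tail e)) :=
    ⟨fun a h => hG _ (key a a h)⟩
  exact Subrelation.wf (r := Relation.TransGen (fun e' e : E => G.head e' = G.tail e))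
    (fun h => .single h) (Finite.wellFounded_of_trans_of_irrefl _)

/-- The messages carried by the edges of an acyclic network. -/
noncomputable def edgeMessage [Finite E] (G : Network V E) (hG : G.IsAcyclic)
    {Msg Key A : Type*} (f : G.Encoding Msg Key A) (e : E) (ω : Msg × Key) : A :=
  hG.wellFounded.fix (C := fun _ => A)
    (fun e prev => f e (fun e' => prev e'.1 e'.2) (fun _ => ω.1) (fun _ => ω.2)) e

theorem edgeMessage_eq [Finite E] (G : Network V E) (hG : G.IsAcyclic)
    {Msg Key A : Type*} (f : G.Encoding Msg Key A) (e : E) (ω : Msg × Key) :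
    G.edgeMessage hG f e ω =
      f e (fun e' => G.edgeMessage hG f e'.1 ω) (fun _ => ω.1) (fun _ => ω.2) :=
  hG.wellFounded.fix_eq _ e

/-- `(R,z)`-feasibility of an arbitrary code with edge alphabet `A`: the message is uniform on
`A ^ R`, and the key is uniform on `Key`. -/
def Feasible [Finite E] [DecidableEq E] (G : Network V E) (hG : G.IsAcyclic) {Key A : Type*}
    [Fintype A] (R z : ℕ) (f : G.Encoding (Fin R → A) Key A) : Prop :=
  G.Decodable (G.edgeMessage hG f) ∧ Secure z (G.edgeMessage hG f)

/-! ### Scalar linear codes -/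

/-- Coefficients of a scalar linear code with `R` message symbols and `k` key symbols: those of the
message on `e` for the messages on other edges, for the message symbols, and for the key symbols.
Only the coefficients for what is available at the tail of `e` are used. -/
abbrev LinearEncoding (E F : Type*) (R k : ℕ) : Type _ := E → (E ⊕ Fin R ⊕ Fin k) → F

/-- The encoding functions with the given coefficients. -/
def LinearEncoding.toEncoding [Fintype E] [DecidableEq V] {F : Type*} [Field F] {R k : ℕ}
    (G : Network V E) (c : LinearEncoding E F R k) : G.Encoding (Fin R → F) (Fin k → F) F :=
  fun e x m n =>
    (∑ e' : G.In (G.tail e), c e (.inl e'.1) * x e') +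
    (if h : G.tail e = G.S then ∑ j : Fin R, c e (.inr (.inl j)) * m h j else 0) +
    (if h : G.tail e = G.K then ∑ j : Fin k, c e (.inr (.inr j)) * n h j else 0)

/-- `(R,z)`-feasibility of a scalar linear code; the decoder is linear, too. -/
def LinearFeasible [Fintype E] [DecidableEq V] [DecidableEq E] (G : Network V E)
    (hG : G.IsAcyclic) {F : Type*} [Field F] [Fintype F] {R k : ℕ} (z : ℕ)
    (c : LinearEncoding E F R k) : Prop :=
  (∃ D : Matrix (Fin R) (G.In G.T) F, ∀ ω : (Fin R → F) × (Fin k → F),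
    D.mulVec (fun e => G.edgeMessage hG (c.toEncoding G) e.1 ω) = ω.1) ∧
  Secure z (G.edgeMessage hG (c.toEncoding G))

/-! ### Time-indexed codes on networks that may have cycles -/

/-- Local encoding functions for `n` time steps: what `e` carries at time `i` is a function of what
the incoming edges of its tail carried before time `i`, and of the source message or the key if the
tail is `S` or `K`. -/
abbrev TimedEncoding (G : Network V E) (n : ℕ) (Msg Key A : Type*) : Type _ :=
  ∀ (i : Fin n) (e : E), ({j : Fin n // j < i} → G.In (G.tail e) → A) →
    (G.tail e = G.S → Msg) → (G.tail e = G.K → Key) → A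

/-- The symbol carried by edge `e` at time `i`. -/
noncomputable def timedSymbol (G : Network V E) {n : ℕ} {Msg Key A : Type*}
    (f : G.TimedEncoding n Msg Key A) (ω : Msg × Key) (i : Fin n) : E → A :=
  (wellFounded_lt (α := Fin n)).fix (C := fun _ => E → A)
    (fun i prev e =>
      f i e (fun j e' => prev j.1 j.2 e'.1) (fun _ => ω.1) (fun _ => ω.2)) i

theorem timedSymbol_eq (G : Network V E) {n : ℕ} {Msg Key A : Type*}
    (f : G.TimedEncoding n Msg Key A) (ω : Msg × Key) (i : Fin n) (e : E) :
    G.timedSymbol f ω i e =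
      f i e (fun j e' => G.timedSymbol f ω j.1 e'.1) (fun _ => ω.1) (fun _ => ω.2) := by
  unfold timedSymbol
  exact congrFun ((wellFounded_lt (α := Fin n)).fix_eq (C := fun _ => E → A) _ i) e

/-- Everything carried by edge `e` during the `n` time steps. -/
noncomputable def timedMessage (G : Network V E) {n : ℕ} {Msg Key A : Type*}
    (f : G.TimedEncoding n Msg Key A) (e : E) (ω : Msg × Key) : Fin n → A :=
  fun i => G.timedSymbol f ω i e

/-- `(R,z)`-feasibility with blocklength `n`: the message is uniform on `A ^ (n R)`. -/
def TimedFeasible [DecidableEq E] (G : Network V E) {n : ℕ} {Key A : Type*}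
    [Fintype A] (R z : ℕ) (f : G.TimedEncoding n (Fin (n * R) → A) Key A) : Prop :=
  G.Decodable (G.timedMessage f) ∧ Secure z (G.timedMessage f)

end Network

/-! Necessity uses secrecy only in a weak form: whatever `z` edges carry under one message can also
occur under any other message, with a suitable key (`WeaklySecure`). If a cut `C` between `K` and
`S` or `T` has fewer than `z` edges, one more edge can be observed along with `C`. Beyond the cut
the key acts only through `C`, so comparing keys that give the same observation shows that two
messages look alike to `T`. The bound `R + z` comes from fixing the symbols on `z` edges of a cut: a
compatible key exists for every message, so the remaining edges must distinguish all messages. The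
arguments need only a well-founded order of computation (`Causal`), so acyclic and time-indexed
codes are treated together.

For sufficiency, edge, message and key symbols become the vertices of one acyclic digraph. The
boundary size of a vertex set is submodular, and a Menger-type induction
(`exists_finrank_span_sourceVec`) finds coefficients for which the symbols in `W` have rank at least
the smallest boundary of a superset of `W`. Such a rank bound means that some minor is nonzero; its
degree does not grow with the field, so by Schwartz-Zippel it survives random coefficients with
probability `1 - O(1/q)`.

Two rank statements give feasibility. `T` receives rank `R + z`, so it decodes message and key
together. On each `W` of at most `z` edges the key columns already have the full rank, so every
change of message can be masked by a shift of the key. For the latter, a minimal key boundary bounds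
the total rank from above: if it has fewer than `z` elements, then by `z ≤ C_{K-S}` no message
symbol can enter except through the boundary (`rank_transferMatrix_le_card_boundary`). -/

/-! ### Zero mutual information as independence -/

theorem unifProb_eq_sum {Ω α : Type*} [Fintype Ω] [DecidableEq α] (X : Ω → α) (a : α) :
    unifProb X a = (∑ ω, if X ω = a then (1 : ℝ) else 0) / Fintype.card Ω := by
  classical
  rw [unifProb, Nat.card_eq_fintype_card, Nat.card_eq_fintype_card, Fintype.card_subtype]
  simp

theorem unifProb_nonneg {Ω α : Type*} (X : Ω → α) (a : α) : 0 ≤ unifProb X a := by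
  unfold unifProb; positivity

theorem sum_unifProb_pair_right {Ω α β : Type*} [Finite Ω] [Fintype β]
    (X : Ω → α) (Y : Ω → β) (a : α) :
    ∑ b, unifProb (fun ω => (X ω, Y ω)) (a, b) = unifProb X a := by
  classical
  have := Fintype.ofFinite Ω
  simp_rw [unifProb_eq_sum, ← Finset.sum_div, Prod.mk.injEq]
  rw [Finset.sum_comm]
  congr 1
  refine Finset.sum_congr rfl fun ω _ => ?_
  by_cases h : X ω = a <;> simp [h]

theorem sum_unifProb_pair_left {Ω α β : Type*} [Finite Ω] [Fintype α]
    (X : Ω → α) (Y : Ω → β) (b : β) :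
    ∑ a, unifProb (fun ω => (X ω, Y ω)) (a, b) = unifProb Y b := by
  classical
  have := Fintype.ofFinite Ω
  simp_rw [unifProb_eq_sum, ← Finset.sum_div, Prod.mk.injEq]
  rw [Finset.sum_comm]
  congr 1
  refine Finset.sum_congr rfl fun ω _ => ?_
  by_cases h : Y ω = b <;> simp [h]

theorem sum_unifProb {Ω α : Type*} [Finite Ω] [Nonempty Ω] [Fintype α] (X : Ω → α) :
    ∑ a, unifProb X a = 1 := by
  classical
  have := Fintype.ofFinite Ω
  simp_rw [unifProb_eq_sum, ← Finset.sum_div]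
  rw [Finset.sum_comm]
  simp

/-- This is `log t ≤ t - 1` at `t = x * y / p`, strict unless `t = 1`. The bounds by the marginals
keep `x` and `y` positive when `p` is. -/
theorem sub_mul_le_relEntropy_term {p x y : ℝ} (hp : 0 ≤ p) (hx : 0 ≤ x) (hy : 0 ≤ y)
    (hpx : p ≤ x) (hpy : p ≤ y) :
    p - x * y ≤ p * Real.log p - p * Real.log x - p * Real.log y ∧
      (p * Real.log p - p * Real.log x - p * Real.log y = p - x * y ↔ p = x * y) := by
  rcases hp.eq_or_lt with rfl | hp
  · have := mul_nonneg hx hy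
    exact ⟨by simpa using this, by simp [eq_comm]⟩
  have hx' := hp.trans_le hpx
  have hy' := hp.trans_le hpy
  have hlog : p * Real.log p - p * Real.log x - p * Real.log y =
      -(p * Real.log (x * y / p)) := by
    rw [Real.log_div (by positivity) hp.ne', Real.log_mul hx'.ne' hy'.ne']; ring
  by_cases h : p = x * y
  · rw [hlog, ← h, div_self hp.ne']; simp
  have hne : x * y / p ≠ 1 := fun h1 => h ((div_eq_one_iff_eq hp.ne').1 h1).symm
  have hlt := mul_lt_mul_of_pos_left (Real.log_lt_sub_one_of_pos (by positivity) hne) hp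
  have he : p * (x * y / p - 1) = x * y - p := by field_simp
  rw [hlog]
  exact ⟨by linarith, ⟨fun h1 => by linarith, fun h1 => absurd h1 h⟩⟩

/-- The joint law and the product of the marginals both have total mass 1, so subtracting their
difference termwise leaves the sum unchanged and makes every summand nonnegative. -/
theorem mutualInfo_eq_zero_iff_indep {Ω α β : Type*} [Finite Ω] [Nonempty Ω] [Fintype α]
    [Fintype β] (X : Ω → α) (Y : Ω → β) :
    mutualInfo X Y = 0 ↔
      ∀ a b, unifProb (fun ω => (X ω, Y ω)) (a, b) = unifProb X a * unifProb Y b := by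
  set p : α → β → ℝ := fun a b => unifProb (fun ω => (X ω, Y ω)) (a, b) with hp
  have hX : ∀ a, ∑ b, p a b = unifProb X a := sum_unifProb_pair_right X Y
  have hY : ∀ b, ∑ a, p a b = unifProb Y b := sum_unifProb_pair_left X Y
  have h0 : ∀ a b, 0 ≤ p a b := fun a b => unifProb_nonneg _ _
  have hpX : ∀ a b, p a b ≤ unifProb X a := fun a b =>
    (Finset.single_le_sum (f := p a) (fun b _ => h0 a b) (Finset.mem_univ b)).trans_eq (hX a)
  have hpY : ∀ a b, p a b ≤ unifProb Y b := fun a b =>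
    (Finset.single_le_sum (f := fun a => p a b) (fun a _ => h0 a b)
      (Finset.mem_univ a)).trans_eq (hY b)
  have hterm := fun a b => sub_mul_le_relEntropy_term (h0 a b) (unifProb_nonneg X a)
    (unifProb_nonneg Y b) (hpX a b) (hpY a b)
  have hI : mutualInfo X Y = ∑ a, ∑ b, (p a b * Real.log (p a b) -
      p a b * Real.log (unifProb X a) - p a b * Real.log (unifProb Y b) -
      (p a b - unifProb X a * unifProb Y b)) := by
    have e1 : ∑ a, ∑ b, p a b * Real.log (unifProb X a) =
        ∑ a, unifProb X a * Real.log (unifProb X a) := by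
      simp_rw [← Finset.sum_mul, hX]
    have e2 : ∑ a, ∑ b, p a b * Real.log (unifProb Y b) =
        ∑ b, unifProb Y b * Real.log (unifProb Y b) := by
      rw [Finset.sum_comm]; simp_rw [← Finset.sum_mul, hY]
    have e3 : ∑ a, ∑ b, p a b = 1 := by simp_rw [hX, sum_unifProb]
    have e4 : ∑ a, ∑ b, unifProb X a * unifProb Y b = 1 := by
      simp_rw [← Finset.mul_sum, sum_unifProb, mul_one, sum_unifProb]
    simp only [Finset.sum_sub_distrib, e1, e2, e3, e4]
    simp only [mutualInfo, shannonEntropy, Fintype.sum_prod_type, Real.negMulLog, neg_mul,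
      Finset.sum_neg_distrib, hp]
    ring
  have hnn : ∀ a b, 0 ≤ p a b * Real.log (p a b) - p a b * Real.log (unifProb X a) -
      p a b * Real.log (unifProb Y b) - (p a b - unifProb X a * unifProb Y b) :=
    fun a b => sub_nonneg.2 (hterm a b).1
  rw [hI, Finset.sum_eq_zero_iff_of_nonneg fun a _ => Finset.sum_nonneg fun b _ => hnn a b]
  simp_rw [Finset.mem_univ, true_imp_iff]
  refine forall_congr' fun a => ?_
  rw [Finset.sum_eq_zero_iff_of_nonneg fun b _ => hnn a b]
  simp_rw [Finset.mem_univ, true_imp_iff]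
  exact forall_congr' fun b => by rw [sub_eq_zero]; exact (hterm a b).2

/-- Secrecy as counting: given the message, the law of `Y` is the number of keys producing each
value. -/
theorem mutualInfo_fst_eq_zero_iff {Msg Key B : Type*} [Fintype Msg] [Nonempty Msg] [Finite Key]
    [Nonempty Key] [Fintype B] (Y : Msg × Key → B) :
    mutualInfo (fun ω : Msg × Key => ω.1) Y = 0 ↔
      ∀ m m' y, Nat.card {k // Y (m, k) = y} = Nat.card {k // Y (m', k) = y} := by
  classical
  have := Fintype.ofFinite Key
  have hM : (0 : ℝ) < Fintype.card Msg := by exact_mod_cast Fintype.card_pos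
  have hK : (0 : ℝ) < Fintype.card Key := by exact_mod_cast Fintype.card_pos
  have hpair : ∀ m y, unifProb (fun ω : Msg × Key => (ω.1, Y ω)) (m, y) =
      Nat.card {k // Y (m, k) = y} / (Fintype.card Msg * Fintype.card Key) := by
    intro m y
    rw [unifProb_eq_sum, Fintype.sum_prod_type, Fintype.card_prod, Nat.card_eq_fintype_card,
      Fintype.card_subtype, Finset.sum_eq_single m]
    · simp
    · intro b _ hb; simp [hb]
    · simp
  have hfst : ∀ m, unifProb (fun ω : Msg × Key => ω.1) m = 1 / Fintype.card Msg := by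
    intro m
    rw [unifProb_eq_sum, Fintype.sum_prod_type, Fintype.card_prod, Finset.sum_eq_single m]
    · simp; field_simp
    · intro b _ hb; simp [hb]
    · simp
  rw [mutualInfo_eq_zero_iff_indep]
  simp_rw [hpair, hfst]
  constructor
  · intro h m m' y
    have h1 := (h m y).trans (h m' y).symm
    rw [div_left_inj' (by positivity)] at h1
    exact_mod_cast h1
  · intro h m y
    rw [← sum_unifProb_pair_left (fun ω : Msg × Key => ω.1) Y y]
    simp_rw [hpair, fun m' => h m' m y]
    simp

/-! ### Converse: necessity of the cut bounds -/

namespace Network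

variable {V E : Type*}

theorem le_mincut [Finite E] (G : Network V E) {A : Set V} {t : V} (ht : t ∉ A) {n : ℕ}
    (h : ∀ C : Finset E, G.IsCut A t C → n ≤ C.card) : n ≤ G.mincut A t := by
  have := Fintype.ofFinite E
  refine le_csInf ⟨_, Finset.univ, fun s hs hst => ?_, rfl⟩ ?_
  · rcases hst.cases_head with rfl | ⟨c, ⟨e, he, -⟩, -⟩
    · exact ht hs
    · exact he (Finset.mem_univ e)
  · rintro _ ⟨C, hC, rfl⟩
    exact h C hC

theorem mincut_le (G : Network V E) {A : Set V} {t : V} {C : Finset E} (h : G.IsCut A t C) :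
    G.mincut A t ≤ C.card :=
  Nat.sInf_le ⟨C, h, rfl⟩

/-- The symbols `X (i, e)` at time `i` on the edge `e` are computed from earlier symbols, where
`r` is the order of computation. -/
def Causal (G : Network V E) {ι Msg Key A : Type*} (r : ι × E → ι × E → Prop)
    (X : ι × E → Msg × Key → A) : Prop :=
  ∀ q ω ω', (∀ p, G.head p.2 = G.tail q.2 → r p q → X p ω = X p ω') →
    (G.tail q.2 = G.S → ω.1 = ω'.1) → (G.tail q.2 = G.K → ω.2 = ω'.2) → X q ω = X q ω'

/-- Secrecy in its weakest form: what is carried by `z` edges never excludes a message. -/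
def WeaklySecure {ι Msg Key A : Type*} (z : ℕ) (X : ι × E → Msg × Key → A) : Prop :=
  ∀ W : Finset E, W.card ≤ z → ∀ m k m', ∃ k', ∀ p : ι × E, p.2 ∈ W → X p (m, k) = X p (m', k')

theorem le_card_of_injective {ι Msg A : Type*} [Fintype ι] [Nonempty ι] [Finite A] [Nontrivial A]
    {R : ℕ} (hM : Nat.card Msg = Nat.card A ^ (Fintype.card ι * R)) {C : Finset E}
    (φ : Msg → ι × {e // e ∈ C} → A) (hφ : Function.Injective φ) : R ≤ C.card := by
  have h := Nat.card_le_card_of_injective φ hφ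
  rw [hM, Nat.card_fun, Nat.card_prod, Nat.card_eq_fintype_card (α := ι),
    Nat.card_eq_fintype_card (α := {e // e ∈ C}), Fintype.card_coe,
    Nat.pow_le_pow_iff_right Finite.one_lt_card] at h
  exact Nat.le_of_mul_le_mul_left h Fintype.card_pos

section Converse

variable {G : Network V E} {ι Msg Key A : Type*} {r : ι × E → ι × E → Prop}
  {X : ι × E → Msg × Key → A}

/-- Induction along `r`: tracing a symbol back from `B` meets either `C` or further nodes of `B`.
Agreement on `C` is needed only before `q`, which allows use inside an induction on `q`. -/
theorem Causal.eq_of_eq_on_cut (hX : G.Causal r X) (hwf : WellFounded r)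
    (htr : ∀ a b c, r a b → r b c → r a c)
    {B : Set V} {C : Finset E} (hB : ∀ e, G.head e ∈ B → e ∉ C → G.tail e ∈ B)
    {ω ω' : Msg × Key} (hS : G.S ∈ B → ω.1 = ω'.1) (hK : G.K ∈ B → ω.2 = ω'.2) (q : ι × E)
    (hC : ∀ p, p.2 ∈ C → r p q → X p ω = X p ω') (hq : G.tail q.2 ∈ B) : X q ω = X q ω' := by
  induction q using hwf.induction with
  | _ q ih =>
    refine hX q ω ω' (fun p hp hr => ?_) (fun h => hS (h ▸ hq)) (fun h => hK (h ▸ hq))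
    by_cases hpC : p.2 ∈ C
    · exact hC p hpC hr
    · exact ih p hr (fun p' hp' hr' => hC p' hp' (htr _ _ _ hr' hr)) (hB _ (hp ▸ hq) hpC)

/-- The nodes from which `t` can be reached without using `C`. -/
def reach (G : Network V E) (C : Finset E) (t : V) : Set V :=
  {v | Relation.ReflTransGen (G.StepAvoiding C) v t}

theorem tail_mem_reach (G : Network V E) {C : Finset E} {t : V} (e : E)
    (he : G.head e ∈ G.reach C t) (heC : e ∉ C) : G.tail e ∈ G.reach C t :=
  Relation.ReflTransGen.head ⟨e, heC, rfl, rfl⟩ he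

theorem mem_reach_self (G : Network V E) (C : Finset E) (t : V) : t ∈ G.reach C t :=
  Relation.ReflTransGen.refl

theorem Causal.eq_at_of_isCut (hX : G.Causal r X) (hwf : WellFounded r)
    (htr : ∀ a b c, r a b → r b c → r a c)
    {D : Set V} {t : V} {C : Finset E} (hC : G.IsCut D t C) {ω ω' : Msg × Key}
    (hS : G.S ∉ D → ω.1 = ω'.1) (hK : G.K ∉ D → ω.2 = ω'.2)
    (h : ∀ p, p.2 ∈ C → X p ω = X p ω') (q : ι × E) (hq : G.head q.2 = t) : X q ω = X q ω' := by
  by_cases hqC : q.2 ∈ C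
  · exact h q hqC
  · exact hX.eq_of_eq_on_cut hwf htr (B := G.reach C t) (G.tail_mem_reach (C := C) (t := t))
      (fun hs => hS fun hD => hC _ hD hs) (fun hs => hK fun hD => hC _ hD hs) q
      (fun p hp _ => h p hp) (G.tail_mem_reach q.2 (hq ▸ G.mem_reach_self C t) hqC)

variable [Nonempty Key] [Nontrivial Msg] {z : ℕ}

/-- With fewer than `z` edges in `C`, no symbol depends on the message once the key is fixed. For a
symbol `q` sent by `S`, secrecy of `C` together with `q` gives a key `k'` under which `m'` imitates
`(m, k)`. By induction the earlier symbols on `C` are the same for `(m', k')` and `(m', k)`, and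
with `m'` they determine `q`. -/
theorem Causal.le_card_of_isCut_key_source (hX : G.Causal r X) (hwf : WellFounded r)
    (htr : ∀ a b c, r a b → r b c → r a c) (hsec : WeaklySecure z X)
    (hdec : ∀ ω ω', (∀ q, G.head q.2 = G.T → X q ω = X q ω') → ω.1 = ω'.1)
    {C : Finset E} (hC : G.IsCut {G.K} G.S C) : z ≤ C.card := by
  classical
  by_contra! hlt
  have key : ∀ q m m' k, X q (m, k) = X q (m', k) := by
    intro q
    induction q using hwf.induction with
    | _ q ih =>
      intro m m' k
      by_cases hq : G.tail q.2 = G.S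
      · obtain ⟨k', hk'⟩ := hsec (insert q.2 C) ((Finset.card_insert_le _ _).trans hlt) m k m'
        rw [hk' q (Finset.mem_insert_self _ _)]
        refine hX.eq_of_eq_on_cut hwf htr (B := G.reach C G.S) (ω := (m', k')) (ω' := (m', k))
          (G.tail_mem_reach (C := C) (t := G.S)) (fun _ => rfl)
          (fun hs => absurd hs (hC _ rfl)) q (fun p hp hr => ?_) (hq ▸ G.mem_reach_self C G.S)
        rw [← hk' p (Finset.mem_insert_of_mem hp), ih p hr m m' k]
      · exact hX q _ _ (fun p _ hr => ih p hr m m' k) (fun h => absurd h hq) (fun _ => rfl)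
  obtain ⟨m, m', hm⟩ := exists_pair_ne Msg
  obtain ⟨k⟩ := ‹Nonempty Key›
  exact hm (hdec (m, k) (m', k) fun q _ => key q m m' k)

/-- One key `k₀` makes `m'` imitate `(m, k)` on `C`. For each symbol `q` entering `T`, another key
`k₁` does so on `C` and `q`. Since `C` cuts off the key, `k₀` and `k₁` give the same `q`, so `k₀`
imitates everything `T` sees. -/
theorem Causal.le_card_of_isCut_key_terminal (hX : G.Causal r X) (hwf : WellFounded r)
    (htr : ∀ a b c, r a b → r b c → r a c) (hsec : WeaklySecure z X)
    (hdec : ∀ ω ω', (∀ q, G.head q.2 = G.T → X q ω = X q ω') → ω.1 = ω'.1)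
    {C : Finset E} (hC : G.IsCut {G.K} G.T C) : z ≤ C.card := by
  classical
  by_contra! hlt
  obtain ⟨m, m', hm⟩ := exists_pair_ne Msg
  obtain ⟨k⟩ := ‹Nonempty Key›
  obtain ⟨k₀, hk₀⟩ := hsec C hlt.le m k m'
  refine hm (hdec (m, k) (m', k₀) fun q hq => ?_)
  obtain ⟨k₁, hk₁⟩ := hsec (insert q.2 C) ((Finset.card_insert_le _ _).trans hlt) m k m'
  rw [hk₁ q (Finset.mem_insert_self _ _)]
  refine hX.eq_at_of_isCut hwf htr hC (ω := (m', k₁)) (ω' := (m', k₀)) (fun _ => rfl)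
    (fun h => absurd rfl h) (fun p hp => ?_) q hq
  rw [← hk₁ p (Finset.mem_insert_of_mem hp), hk₀ p hp]

theorem Causal.cutBounds [Fintype ι] [Nonempty ι] [Finite A] [Nontrivial A] [Finite E]
    (hX : G.Causal r X) (hwf : WellFounded r)
    (htr : ∀ a b c, r a b → r b c → r a c)
    (hKS : G.K ≠ G.S) (hKT : G.K ≠ G.T) (hST : G.S ≠ G.T) {R : ℕ} (hR : 0 < R)
    (hM : Nat.card Msg = Nat.card A ^ (Fintype.card ι * R))
    (hsec : WeaklySecure z X)
    (hdec : ∀ ω ω', (∀ q, G.head q.2 = G.T → X q ω = X q ω') → ω.1 = ω'.1) :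
    G.CutBounds R z := by
  classical
  refine ⟨le_min (G.le_mincut (by simpa using hKS.symm) fun C hC => ?_)
    (G.le_mincut (by simpa using hKT.symm) fun C hC => ?_),
    G.le_mincut (by simpa using hST.symm) fun C hC => ?_,
    G.le_mincut (by simpa using ⟨hKT.symm, hST.symm⟩) fun C hC => ?_⟩
  · exact hX.le_card_of_isCut_key_source hwf htr hsec hdec hC
  · exact hX.le_card_of_isCut_key_terminal hwf htr hsec hdec hC
  · obtain ⟨k⟩ := ‹Nonempty Key›
    refine le_card_of_injective hM (fun m p => X (p.1, p.2.1) (m, k)) fun m m' h => ?_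
    exact hdec (m, k) (m', k) (hX.eq_at_of_isCut hwf htr hC (fun h => absurd rfl h)
      (fun _ => rfl) fun p hp => congrFun h (p.1, ⟨p.2, hp⟩))
  · obtain ⟨k₀⟩ := ‹Nonempty Key›
    obtain ⟨m₀⟩ := (inferInstance : Nonempty Msg)
    -- The minimum covers cuts with fewer than `z` edges: there `C \ W` is empty, which contradicts
    -- `0 < R` at the end.
    obtain ⟨W, hWC, hW⟩ := Finset.exists_subset_card_eq (min_le_right z C.card)
    choose k hk using hsec W (hW ▸ min_le_left _ _) m₀ k₀
    have : R ≤ (C \ W).card := by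
      refine le_card_of_injective hM (fun m p => X (p.1, p.2.1) (m, k m)) fun m m' h => ?_
      refine hdec (m, k m) (m', k m') (hX.eq_at_of_isCut hwf htr hC
        (fun h => absurd (by simp) h) (fun h => absurd (by simp) h) fun p hp => ?_)
      by_cases hpW : p.2 ∈ W
      · rw [← hk m p hpW, hk m' p hpW]
      · exact congrFun h (p.1, ⟨p.2, Finset.mem_sdiff.2 ⟨hp, hpW⟩⟩)
    rw [Finset.card_sdiff_of_subset hWC] at this
    omega

end Converse

theorem exists_key_of_mutualInfo_eq_zero {Msg Key B : Type*} [Fintype Msg] [Finite Key]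
    [Fintype B] {Y : Msg × Key → B} (h : mutualInfo (fun ω : Msg × Key => ω.1) Y = 0)
    (m : Msg) (k : Key) (m' : Msg) : ∃ k', Y (m, k) = Y (m', k') := by
  have : Nonempty Msg := ⟨m⟩
  have : Nonempty Key := ⟨k⟩
  have h1 := (mutualInfo_fst_eq_zero_iff Y).1 h m m' (Y (m, k))
  have : Nonempty {k' // Y (m, k') = Y (m, k)} := ⟨k, rfl⟩
  have : 0 < Nat.card {k' // Y (m', k') = Y (m, k)} := h1 ▸ Nat.card_pos
  obtain ⟨k', hk'⟩ := (Nat.card_pos_iff.1 this).1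
  exact ⟨k', hk'.symm⟩

theorem Feasible.cutBounds [Finite E] [DecidableEq E] {G : Network V E} {hG : G.IsAcyclic}
    (hKS : G.K ≠ G.S) (hKT : G.K ≠ G.T) (hST : G.S ≠ G.T) {R z : ℕ} (hR : 0 < R)
    {A Key : Type*} [Fintype A] [Nontrivial A] [Finite Key] [Nonempty Key]
    {f : G.Encoding (Fin R → A) Key A} (hf : G.Feasible hG R z f) : G.CutBounds R z := by
  obtain ⟨⟨g, hg⟩, hsec⟩ := hf
  have : Nonempty (Fin R) := ⟨⟨0, hR⟩⟩
  let r₀ : E → E → Prop := Relation.TransGen fun e' e => G.head e' = G.tail e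
  have hr₀ : WellFounded r₀ := hG.wellFounded.transGen
  -- An acyclic code has a single time step; the order of computation is the ancestor relation on
  -- edges.
  refine Causal.cutBounds (ι := Unit) (r := fun p q => r₀ p.2 q.2)
    (X := fun p => G.edgeMessage hG f p.2) ?_ (InvImage.wf Prod.snd hr₀)
    (fun a b c => Relation.TransGen.trans) hKS hKT hST hR (by simp) ?_ ?_
  · rintro ⟨i, e⟩ ω ω' h hS hK
    change G.edgeMessage hG f e ω = G.edgeMessage hG f e ω'
    rw [edgeMessage_eq, edgeMessage_eq]
    congr 1
    · funext e'
      exact h (i, e'.1) e'.2 (.single e'.2)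
    · funext he; exact hS he
    · funext he; exact hK he
  · intro W hW m k m'
    obtain ⟨k', hk'⟩ := exists_key_of_mutualInfo_eq_zero (hsec W hW) m k m'
    exact ⟨k', fun p hp => congrFun hk' ⟨p.2, hp⟩⟩
  · intro ω ω' h
    rw [← hg ω, ← hg ω']
    congr 1
    funext e
    exact h ((), e.1) e.2

theorem TimedFeasible.cutBounds [Finite E] [DecidableEq E] {G : Network V E}
    (hKS : G.K ≠ G.S) (hKT : G.K ≠ G.T) (hST : G.S ≠ G.T) {R z n : ℕ} (hR : 0 < R) (hn : 0 < n)
    {A Key : Type*} [Fintype A] [Nontrivial A] [Finite Key] [Nonempty Key]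
    {f : G.TimedEncoding n (Fin (n * R) → A) Key A} (hf : G.TimedFeasible R z f) :
    G.CutBounds R z := by
  obtain ⟨⟨g, hg⟩, hsec⟩ := hf
  have : Nonempty (Fin (n * R)) := ⟨⟨0, Nat.mul_pos hn hR⟩⟩
  have : Nonempty (Fin n) := ⟨⟨0, hn⟩⟩
  refine Causal.cutBounds (ι := Fin n) (r := fun p q => p.1 < q.1)
    (X := fun p ω => G.timedSymbol f ω p.1 p.2) ?_ (InvImage.wf Prod.fst wellFounded_lt)
    (fun a b c => lt_trans) hKS hKT hST hR (by simp) ?_ ?_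
  · rintro ⟨i, e⟩ ω ω' h hS hK
    change G.timedSymbol f ω i e = G.timedSymbol f ω' i e
    rw [timedSymbol_eq, timedSymbol_eq]
    congr 1
    · funext j e'
      exact h (j.1, e'.1) e'.2 j.2
    · funext he; exact hS he
    · funext he; exact hK he
  · intro W hW m k m'
    obtain ⟨k', hk'⟩ := exists_key_of_mutualInfo_eq_zero (hsec W hW) m k m'
    exact ⟨k', fun p hp => congrFun (congrFun hk' ⟨p.2, hp⟩) p.1⟩
  · intro ω ω' h
    rw [← hg ω, ← hg ω']
    congr 1
    funext e i
    exact h (i, e.1) e.2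

end Network

/-! ### Linear coding on acyclic digraphs and a Menger-type rank bound -/

/-- A digraph given by its in-neighbourhoods, with a height function that shows it to be acyclic. -/
structure RankedDigraph (P : Type*) where
  pred : P → Finset P
  height : P → ℕ
  height_lt : ∀ p, ∀ q ∈ pred p, height q < height p

namespace RankedDigraph

theorem height_induction {P : Type*} (D : RankedDigraph P) {motive : P → Prop}
    (h : ∀ p, (∀ q ∈ D.pred p, motive q) → motive p) (p : P) : motive p := by
  induction p using (measure D.height).wf.induction with
  | _ p ih => exact h p fun q hq => ih q (D.height_lt p q hq)

variable {P : Type*} [DecidableEq P]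

section Transfer

variable {A : Type*} [CommRing A]

/-- The global coding vectors: every vertex injects a symbol of its own and adds a linear
combination, with coefficients `c`, of the symbols of its in-neighbours. -/
noncomputable def transfer (D : RankedDigraph P) (c : P → P → A) : P → P → A :=
  (measure D.height).wf.fix fun p T =>
    Pi.single p 1 + ∑ q ∈ (D.pred p).attach, c p q.1 • T q.1 (D.height_lt p q.1 q.2)

theorem transfer_eq (D : RankedDigraph P) (c : P → P → A) (p : P) :
    D.transfer c p = Pi.single p 1 + ∑ q ∈ D.pred p, c p q • D.transfer c q := by
  rw [transfer, WellFounded.fix_eq]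
  congr 1
  exact Finset.sum_attach (D.pred p) fun q => c p q • D.transfer c q

theorem map_transfer (D : RankedDigraph P) {B : Type*} [CommRing B] (φ : A →+* B)
    (c : P → P → A) (p a : P) :
    φ (D.transfer c p a) = D.transfer (fun p q => φ (c p q)) p a := by
  induction p using D.height_induction with
  | h p ih =>
    rw [transfer_eq, transfer_eq]
    simp only [Pi.add_apply, Finset.sum_apply, Pi.smul_apply, smul_eq_mul, map_add, map_sum,
      map_mul]
    congr 1
    · by_cases h : a = p
      · subst h; simp
      · simp [Pi.single_eq_of_ne h]
    · exact Finset.sum_congr rfl fun q hq => by rw [ih q hq]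

/-- The part of the coding vector of `p` which belongs to the sources `src j`. -/
noncomputable def sourceVec (D : RankedDigraph P) {J : Type*} (src : J → P) (c : P → P → A)
    (p : P) : J → A :=
  fun j => D.transfer c p (src j)

variable (D : RankedDigraph P) {J : Type*} {src : J → P}

theorem sourceVec_of_not_source {c : P → P → A} {p : P} (hp : ∀ j, src j ≠ p) :
    D.sourceVec src c p = ∑ q ∈ D.pred p, c p q • D.sourceVec src c q := by
  funext j
  rw [sourceVec, transfer_eq]
  simp [sourceVec, Finset.sum_apply, Pi.single_eq_of_ne (hp j)]

theorem sourceVec_source [DecidableEq J] (hinj : Function.Injective src)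
    (hsrc : ∀ j, D.pred (src j) = ∅) (c : P → P → A) (j : J) :
    D.sourceVec src c (src j) = Pi.single j 1 := by
  funext i
  rw [sourceVec, transfer_eq, hsrc]
  by_cases h : i = j
  · subst h; simp
  · rw [Finset.sum_empty, add_zero, Pi.single_eq_of_ne h, Pi.single_eq_of_ne (hinj.ne h)]

end Transfer

section Boundary

variable (D : RankedDigraph P) {J : Type*} (src : J → P)

open Classical in
/-- The vertices of `U` at which paths from the sources may enter `U`. -/
noncomputable def boundary (U : Finset P) : Finset P :=
  {u ∈ U | (∃ j, src j = u) ∨ ¬ D.pred u ⊆ U}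

open Classical in
/-- The vertices of `U` that are neither sources nor in the boundary of `U`. -/
noncomputable def interior (U : Finset P) : Finset P :=
  {u ∈ U | ¬ ((∃ j, src j = u) ∨ ¬ D.pred u ⊆ U)}

variable {D src}

theorem mem_boundary {U : Finset P} {u : P} :
    u ∈ D.boundary src U ↔ u ∈ U ∧ ((∃ j, src j = u) ∨ ¬ D.pred u ⊆ U) := by
  simp [boundary]

theorem mem_interior {U : Finset P} {u : P} :
    u ∈ D.interior src U ↔ u ∈ U ∧ (∀ j, src j ≠ u) ∧ D.pred u ⊆ U := by
  simp [interior]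

theorem card_boundary_add_card_interior (U : Finset P) :
    (D.boundary src U).card + (D.interior src U).card = U.card := by
  classical
  exact Finset.card_filter_add_card_filter_not _

/-- Submodularity. Boundary size is `U.card`, which is modular, minus the interior size, which is
supermodular: interiors commute with intersections, and the interior of a union contains the union
of the interiors. -/
theorem card_boundary_union_add_inter (U U' : Finset P) :
    (D.boundary src (U ∪ U')).card + (D.boundary src (U ∩ U')).card ≤
      (D.boundary src U).card + (D.boundary src U').card := by
  have h1 : (D.interior src (U ∩ U')) = D.interior src U ∩ D.interior src U' := by
    ext u
    simp only [mem_interior, Finset.mem_inter, Finset.subset_inter_iff]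
    tauto
  have h2 : D.interior src U ∪ D.interior src U' ⊆ D.interior src (U ∪ U') := by
    intro u
    simp only [mem_interior, Finset.mem_union]
    rintro (⟨a, b, c⟩ | ⟨a, b, c⟩)
    · exact ⟨.inl a, b, c.trans Finset.subset_union_left⟩
    · exact ⟨.inr a, b, c.trans Finset.subset_union_right⟩
  have h3 := Finset.card_le_card h2
  have h4 := Finset.card_union_add_card_inter (D.interior src U) (D.interior src U')
  have h5 := Finset.card_union_add_card_inter U U'
  rw [← h1] at h4
  have := card_boundary_add_card_interior (D := D) (src := src) U
  have := card_boundary_add_card_interior (D := D) (src := src) U'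
  have := card_boundary_add_card_interior (D := D) (src := src) (U ∪ U')
  have := card_boundary_add_card_interior (D := D) (src := src) (U ∩ U')
  omega

theorem boundary_insert_subset (U : Finset P) (e : P) :
    D.boundary src (insert e U) ⊆ insert e (D.boundary src U) := by
  intro u
  simp only [mem_boundary, Finset.mem_insert]
  rintro ⟨rfl | hu, h⟩
  · exact .inl rfl
  · exact .inr ⟨hu, h.imp_right fun h h' => h (h'.trans (Finset.subset_insert _ _))⟩

theorem boundary_insert_subset_of_pred_subset {U : Finset P} {e : P} (he : ∀ j, src j ≠ e)
    (hU : D.pred e ⊆ U) : D.boundary src (insert e U) ⊆ D.boundary src U := by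
  intro u hu
  rcases Finset.mem_insert.1 (boundary_insert_subset U e hu) with rfl | h
  · rcases (mem_boundary.1 hu).2 with ⟨j, hj⟩ | h
    · exact absurd hj (he j)
    · exact absurd (hU.trans (Finset.subset_insert _ _)) h
  · exact h

/-- A non-source vertex `e` of a set can be replaced by an in-neighbour of `e` such that the least
size of the boundary of a superset does not drop. -/
theorem exists_pred_forall_le_card_boundary {W : Finset P} {e : P} {k : ℕ}
    (he : ∀ j, src j ≠ e)
    (h : ∀ U, insert e W ⊆ U → k ≤ (D.boundary src U).card)
    (hW : ∃ U, W ⊆ U ∧ (D.boundary src U).card < k) :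
    ∃ p ∈ D.pred e, ∀ U, insert p W ⊆ U → k ≤ (D.boundary src U).card := by
  by_contra! hcon
  -- Adding `e` costs at most one boundary vertex, so boundaries of supersets of `W` have size at
  -- least `k - 1`. By submodularity, two supersets of `W` with boundary below `k` then have a union
  -- with boundary below `k`.
  have hlow : ∀ U, W ⊆ U → k ≤ (D.boundary src U).card + 1 := fun U hU =>
    (h _ (Finset.insert_subset_insert e hU)).trans
      ((Finset.card_le_card (boundary_insert_subset U e)).trans (Finset.card_insert_le _ _))
  have hstep : ∀ Q ⊆ D.pred e, ∃ U, W ⊆ U ∧ Q ⊆ U ∧ (D.boundary src U).card < k := by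
    intro Q
    induction Q using Finset.induction_on with
    | empty => exact fun _ => hW.imp fun U hU => ⟨hU.1, by simp, hU.2⟩
    | insert p Q _ ih =>
      intro hQ
      obtain ⟨U, h1, h2, h3⟩ := ih ((Finset.subset_insert _ _).trans hQ)
      obtain ⟨U', h4, h5⟩ := hcon p (hQ (Finset.mem_insert_self _ _))
      obtain ⟨h6, h7⟩ := Finset.insert_subset_iff.1 h4
      refine ⟨U ∪ U', h1.trans Finset.subset_union_left, Finset.insert_subset_iff.2
        ⟨Finset.mem_union_right _ h6, h2.trans Finset.subset_union_left⟩, ?_⟩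
      have := card_boundary_union_add_inter (D := D) (src := src) U U'
      have := hlow (U ∩ U') (Finset.subset_inter h1 h7)
      omega
  -- This `U` contains all in-neighbours of `e`, so adding `e` does not enlarge its boundary.
  obtain ⟨U, h1, h2, h3⟩ := hstep _ subset_rfl
  exact absurd (h _ (Finset.insert_subset_insert e h1)) (not_le.2
    ((Finset.card_le_card (boundary_insert_subset_of_pred_subset he h2)).trans_lt h3))

end Boundary

section Rank

variable (D : RankedDigraph P) {J : Type*} {src : J → P} {F : Type*} [Field F]

theorem sourceVec_congr_of_height_le {c c' : P → P → F} {e : P}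
    (hc : ∀ p, p ≠ e → c p = c' p) (p : P) (hp : p ≠ e) (hpe : D.height p ≤ D.height e) :
    D.sourceVec src c p = D.sourceVec src c' p := by
  suffices D.transfer c p = D.transfer c' p by unfold sourceVec; rw [this]
  induction p using D.height_induction with
  | h p ih =>
    rw [transfer_eq, transfer_eq, hc p hp]
    congr 1
    refine Finset.sum_congr rfl fun q hq => ?_
    have hlt := (D.height_lt p q hq).trans_le hpe
    rw [ih q hq (by rintro rfl; exact hlt.false) hlt.le]

/-- This is routing along disjoint paths, built backwards. The highest non-source vertex of `W` is
either dropped or made to copy a suitable in-neighbour that replaces it in `W`; the sum of `height +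
1` decreases until only sources, with their unit vectors, are left. -/
theorem exists_finrank_span_sourceVec [Finite J] (hinj : Function.Injective src)
    (hsrc : ∀ j, D.pred (src j) = ∅) (W : Finset P) (k : ℕ)
    (h : ∀ U, W ⊆ U → k ≤ (D.boundary src U).card) :
    ∃ c : P → P → F, k ≤ Module.finrank F (Submodule.span F (D.sourceVec src c '' W)) := by
  classical
  induction hn : ∑ w ∈ W, (D.height w + 1) using Nat.strong_induction_on generalizing W with
  | _ n ih =>
  subst hn
  by_cases hWs : ∀ w ∈ W, ∃ j, src j = w
  · refine ⟨0, (h W subset_rfl).trans ?_⟩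
    choose j hj using hWs
    have hli : LinearIndependent F (fun w : W => D.sourceVec src (0 : P → P → F) w) := by
      have he : (fun w : W => D.sourceVec src (0 : P → P → F) w) =
          (fun i => Pi.single i (1 : F)) ∘ fun w : W => j w.1 w.2 := by
        funext w
        rw [Function.comp_apply, ← D.sourceVec_source hinj hsrc 0, hj]
      rw [he]
      refine (Pi.linearIndependent_single_one J F).comp _ fun w w' hw => ?_
      rw [Subtype.ext_iff, ← hj w.1 w.2, ← hj w'.1 w'.2]
      exact congrArg src hw
    have hc := finrank_span_eq_card hli
    rw [Fintype.card_coe] at hc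
    rw [Set.image_eq_range]
    exact (Finset.card_le_card (Finset.filter_subset _ _)).trans hc.ge
  · push Not at hWs
    obtain ⟨w₀, hw₀, hw₀s⟩ := hWs
    -- Maximal height ensures that changing the coefficients at `e` leaves the vectors of the rest
    -- of `W` unchanged.
    obtain ⟨e, he, hmax⟩ := ({w ∈ W | ∀ j, src j ≠ w} : Finset P).exists_max_image D.height
      ⟨w₀, by simp [hw₀, hw₀s]⟩
    rw [Finset.mem_filter] at he
    obtain ⟨heW, hes⟩ := he
    have hWe : insert e (W.erase e) = W := Finset.insert_erase heW
    have hsum := Finset.add_sum_erase W (fun w => D.height w + 1) heW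
    by_cases hW' : ∃ U, W.erase e ⊆ U ∧ (D.boundary src U).card < k
    · obtain ⟨p, hp, hpk⟩ := exists_pred_forall_le_card_boundary hes (by rwa [hWe]) hW'
      have hpe := D.height_lt e p hp
      obtain ⟨c, hc⟩ := ih _ (by
        have : ∑ w ∈ insert p (W.erase e), (D.height w + 1) ≤
            (D.height p + 1) + ∑ w ∈ W.erase e, (D.height w + 1) := by
          by_cases hpW : p ∈ W.erase e
          · rw [Finset.insert_eq_of_mem hpW]; omega
          · rw [Finset.sum_insert hpW]
        omega) (insert p (W.erase e)) hpk rfl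
      let c' : P → P → F := Function.update c e (Pi.single p 1)
      have hcc' : ∀ p, p ≠ e → c p = c' p := fun p hp => (Function.update_of_ne hp _ _).symm
      have hep : D.sourceVec src c' e = D.sourceVec src c p := by
        rw [D.sourceVec_of_not_source hes, Finset.sum_eq_single_of_mem p hp,
          D.sourceVec_congr_of_height_le hcc' p (by rintro rfl; exact hpe.false) hpe.le]
        · simp [c']
        · intro q _ hq; simp [c', Pi.single_eq_of_ne hq]
      have hWc : ∀ w ∈ W.erase e, D.sourceVec src c' w = D.sourceVec src c w := by
        intro w hw
        obtain ⟨hwe, hwW⟩ := Finset.mem_erase.1 hw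
        by_cases hws : ∀ j, src j ≠ w
        · exact (D.sourceVec_congr_of_height_le hcc' w hwe
            (hmax w (Finset.mem_filter.2 ⟨hwW, hws⟩))).symm
        · push Not at hws
          obtain ⟨j, rfl⟩ := hws
          rw [D.sourceVec_source hinj hsrc, D.sourceVec_source hinj hsrc]
      have himg : D.sourceVec src c' '' (W : Set P) =
          D.sourceVec src c '' (insert p (W.erase e) : Finset P) := by
        conv_lhs => rw [← hWe, Finset.coe_insert, Set.image_insert_eq, hep,
          Set.image_congr (s := (W.erase e : Set P)) fun w hw => hWc w hw]
        rw [Finset.coe_insert, Set.image_insert_eq]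
      exact ⟨c', himg ▸ hc⟩
    · push Not at hW'
      obtain ⟨c, hc⟩ := ih _ (by omega) (W.erase e) hW' rfl
      exact ⟨c, hc.trans (Submodule.finrank_mono (Submodule.span_mono
        (Set.image_mono (by exact_mod_cast Finset.erase_subset e W))))⟩

theorem sourceVec_mem_span {N B : Finset P}
    (h : ∀ p ∈ N, p ∉ B → (∀ j, src j ≠ p) ∧ D.pred p ⊆ N) (c : P → P → F) (p : P) (hp : p ∈ N) :
    D.sourceVec src c p ∈ Submodule.span F (D.sourceVec src c '' B) := by
  induction p using D.height_induction with
  | h p ih =>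
    by_cases hpB : p ∈ B
    · exact Submodule.subset_span ⟨p, hpB, rfl⟩
    · rw [D.sourceVec_of_not_source (h p hp hpB).1]
      exact Submodule.sum_mem _ fun q hq => Submodule.smul_mem _ _ (ih q hq ((h p hp hpB).2 hq))

end Rank

end RankedDigraph

/-! ### Rank and nonvanishing minors -/

section Minors

open Matrix

variable {m n F : Type*} [Field F]

theorem Matrix.exists_linearIndependent_rows [Finite m] [Fintype n] (M : Matrix m n F) {k : ℕ}
    (hk : k ≤ M.rank) : ∃ f : Fin k → m, LinearIndependent F (M.submatrix f id).row := by
  rw [Matrix.rank_eq_finrank_span_row] at hk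
  obtain ⟨v, hv, -, hli⟩ := Submodule.exists_fun_fin_finrank_span_eq F (Set.range M.row)
  choose f hf using hv
  refine ⟨f ∘ Fin.castLE hk, ?_⟩
  have : (M.submatrix (f ∘ Fin.castLE hk) id).row = v ∘ Fin.castLE hk := by
    funext i
    rw [Function.comp_apply, ← hf]
    rfl
  rw [this]
  exact hli.comp _ (Fin.castLE_injective hk)

theorem Matrix.exists_det_submatrix_ne_zero [Finite m] [Fintype n] (M : Matrix m n F) {k : ℕ}
    (hk : k ≤ M.rank) : ∃ (f : Fin k → m) (g : Fin k → n), (M.submatrix f g).det ≠ 0 := by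
  obtain ⟨f, hf⟩ := M.exists_linearIndependent_rows hk
  have hr : k ≤ (M.submatrix f id)ᵀ.rank := by
    rw [Matrix.rank_transpose, hf.rank_matrix, Fintype.card_fin]
  obtain ⟨g, hg⟩ := (M.submatrix f id)ᵀ.exists_linearIndependent_rows hr
  refine ⟨f, g, ?_⟩
  have := Matrix.linearIndependent_rows_iff_isUnit.1 hg
  rw [Matrix.isUnit_iff_isUnit_det, isUnit_iff_ne_zero, ← Matrix.det_transpose] at this
  exact this

theorem Matrix.le_rank_of_det_submatrix_ne_zero [Fintype n] (M : Matrix m n F)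
    {k : ℕ} {f : Fin k → m} {g : Fin k → n} (h : (M.submatrix f g).det ≠ 0) : k ≤ M.rank := by
  have := M.rank_submatrix_le f g
  rwa [Matrix.rank_of_det_ne_zero h, Fintype.card_fin] at this

end Minors

/-! ### Schwartz-Zippel and generic properties, uniformly in the field -/

namespace MvPolynomial

theorem totalDegree_map_le {σ R S : Type*} [CommSemiring R] [CommSemiring S] (φ : R →+* S)
    (p : MvPolynomial σ R) : (map φ p).totalDegree ≤ p.totalDegree :=
  Finset.sup_mono (support_map_subset φ p)

theorem card_zeros_div_le {σ F : Type*} [Finite σ] [Field F] [Fintype F] {p : MvPolynomial σ F}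
    (hp : p ≠ 0) :
    (Nat.card {x : σ → F // eval x p = 0} : ℝ) / Nat.card (σ → F) ≤
      p.totalDegree / Fintype.card F := by
  classical
  have := Fintype.ofFinite σ
  let ε := Fintype.equivFin σ
  have h := schwartz_zippel_totalDegree (p := rename ε p)
    (fun h => hp (rename_injective _ ε.injective (h.trans (map_zero _).symm))) Finset.univ
  have heval : ∀ x : σ → F, eval (Equiv.arrowCongr ε (.refl F) x) (rename ε p) = eval x p := by
    intro x
    rw [eval_rename]
    congr 2
    funext i
    simp
  have hcard : Nat.card {x : σ → F // eval x p = 0} =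
      ({f ∈ Fintype.piFinset fun _ => (Finset.univ : Finset F) | eval f (rename ε p) = 0} :
        Finset (Fin (Fintype.card σ) → F)).card := by
    rw [Nat.card_congr ((Equiv.arrowCongr ε (.refl F)).subtypeEquiv 
        (q := fun f => eval f (rename ε p) = 0) fun x => by rw [heval]),
      Nat.card_eq_fintype_card, Fintype.card_subtype, Fintype.piFinset_univ]
  have hdeg := totalDegree_rename_le (R := F) ε p
  rw [← hcard, Finset.card_univ] at h
  have h' : (Nat.card {x : σ → F // eval x p = 0} : ℝ) / (Fintype.card F : ℝ) ^ Fintype.card σ ≤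
      (rename ε p).totalDegree / Fintype.card F := by
    have := (NNRat.cast_le (K := ℝ)).2 h
    push_cast at this
    exact this
  rw [Nat.card_fun, Nat.card_eq_fintype_card (α := F), Nat.card_eq_fintype_card (α := σ)]
  push_cast
  refine h'.trans ?_
  gcongr

end MvPolynomial

/-- `Q F x` holds for all `x` outside the zero set of a nonzero polynomial over `F`, whose degree is
bounded independently of the field `F`. -/
def HoldsGenerically {σ : Type*} (Q : ∀ (F : Type) [Field F], (σ → F) → Prop) : Prop :=
  ∃ d : ℕ, ∀ (F : Type) [Field F], ∃ p : MvPolynomial σ F, p ≠ 0 ∧ p.totalDegree ≤ d ∧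
    ∀ x, MvPolynomial.eval x p ≠ 0 → Q F x

namespace HoldsGenerically

variable {σ : Type*}

theorem mono {Q Q' : ∀ (F : Type) [Field F], (σ → F) → Prop} (hQ : HoldsGenerically Q)
    (h : ∀ (F : Type) [Field F] (x : σ → F), Q F x → Q' F x) : HoldsGenerically Q' := by
  obtain ⟨d, hd⟩ := hQ
  refine ⟨d, fun F _ => ?_⟩
  obtain ⟨p, h1, h2, h3⟩ := hd F
  exact ⟨p, h1, h2, fun x hx => h F x (h3 x hx)⟩

theorem forall_finite {ι : Type*} [Finite ι] {Q : ι → ∀ (F : Type) [Field F], (σ → F) → Prop}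
    (hQ : ∀ i, HoldsGenerically (Q i)) : HoldsGenerically fun F _ x => ∀ i, Q i F x := by
  have := Fintype.ofFinite ι
  choose d hd using hQ
  refine ⟨∑ i, d i, fun F _ => ?_⟩
  choose p h1 h2 h3 using fun i => hd i F
  refine ⟨∏ i, p i, Finset.prod_ne_zero_iff.2 fun i _ => h1 i,
    (MvPolynomial.totalDegree_finsetProd _ _).trans (Finset.sum_le_sum fun i _ => h2 i),
    fun x hx i => h3 i x ?_⟩
  rw [map_prod, Finset.prod_ne_zero_iff] at hx
  exact hx i (Finset.mem_univ i)

theorem and {Q Q' : ∀ (F : Type) [Field F], (σ → F) → Prop} (hQ : HoldsGenerically Q)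
    (hQ' : HoldsGenerically Q') : HoldsGenerically fun F _ x => Q F x ∧ Q' F x := by
  obtain ⟨d, hd⟩ := hQ
  obtain ⟨d', hd'⟩ := hQ'
  refine ⟨d + d', fun F _ => ?_⟩
  obtain ⟨p, h1, h2, h3⟩ := hd F
  obtain ⟨p', h1', h2', h3'⟩ := hd' F
  refine ⟨p * p', mul_ne_zero h1 h1', (MvPolynomial.totalDegree_mul _ _).trans (by omega),
    fun x hx => ?_⟩
  rw [map_mul] at hx
  exact ⟨h3 x (left_ne_zero_of_mul hx), h3' x (right_ne_zero_of_mul hx)⟩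

theorem exists_probability_bound [Finite σ] {Q : ∀ (F : Type) [Field F], (σ → F) → Prop}
    (hQ : HoldsGenerically Q) : ∃ C : ℝ, ∀ (F : Type) [Field F] [Fintype F],
      1 - C / (Fintype.card F : ℝ) ≤
        (Nat.card {x : σ → F // Q F x} : ℝ) / (Nat.card (σ → F) : ℝ) := by
  classical
  obtain ⟨d, hd⟩ := hQ
  refine ⟨d, fun F _ _ => ?_⟩
  have := Fintype.ofFinite σ
  obtain ⟨p, h1, h2, h3⟩ := hd F
  have hz := MvPolynomial.card_zeros_div_le h1
  have hpos : (0 : ℝ) < Nat.card (σ → F) := by exact_mod_cast Nat.card_pos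
  have hle : Nat.card (σ → F) ≤ Nat.card {x : σ → F // MvPolynomial.eval x p = 0} +
      Nat.card {x : σ → F // Q F x} := by
    rw [Nat.card_eq_fintype_card, Nat.card_eq_fintype_card, Nat.card_eq_fintype_card,
      Fintype.card_subtype, Fintype.card_subtype, ← Finset.card_univ]
    refine (Finset.card_le_card fun x _ => ?_).trans (Finset.card_union_le _ _)
    by_cases hx : MvPolynomial.eval x p = 0
    · simp [hx]
    · simp [h3 x hx]
  have hle' : (Nat.card (σ → F) : ℝ) ≤ Nat.card {x : σ → F // MvPolynomial.eval x p = 0} +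
      Nat.card {x : σ → F // Q F x} := by exact_mod_cast hle
  have hdq : (p.totalDegree : ℝ) / Fintype.card F ≤ d / Fintype.card F := by gcongr
  have h4 := div_le_div_of_nonneg_right hle' hpos.le
  rw [div_self hpos.ne', add_div] at h4
  linarith

end HoldsGenerically

-- The rank hypothesis makes the key columns span the whole range of `Y`. The effect of replacing
-- `x` by `x'` is thus undone by adding a fixed vector `v` to the key, and this shift is a bijection
-- between the keys compatible with `x` and with `x'`.
open Matrix in
theorem mutualInfo_fst_mulVec_eq_zero {W m k F : Type*} [Fintype W] [Fintype m] [Fintype k]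
    [DecidableEq m] [DecidableEq k] [DecidableEq W] [Field F] [Fintype F] (Y : Matrix W (m ⊕ k) F)
    (hY : Y.rank ≤ (Y.submatrix id Sum.inr).rank) :
    mutualInfo (fun ω : (m → F) × (k → F) => ω.1)
      (fun ω => Y *ᵥ Sum.elim ω.1 ω.2) = 0 := by
  rw [mutualInfo_fst_eq_zero_iff]
  intro x x' y
  have hinr : ∀ v : k → F, Y.submatrix id Sum.inr *ᵥ v = Y *ᵥ Sum.elim 0 v := by
    intro v
    funext w
    simp [Matrix.mulVec, dotProduct, Fintype.sum_sum_type]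
  have hrange : LinearMap.range (Y.submatrix id Sum.inr).mulVecLin =
      LinearMap.range Y.mulVecLin := by
    refine Submodule.eq_of_le_of_finrank_le ?_ hY
    rintro _ ⟨v, rfl⟩
    exact ⟨Sum.elim 0 v, (hinr v).symm⟩
  obtain ⟨v, hv⟩ : Y.mulVecLin (Sum.elim (x - x') 0) ∈
      LinearMap.range (Y.submatrix id Sum.inr).mulVecLin := hrange ▸ ⟨_, rfl⟩
  rw [Matrix.mulVecLin_apply, Matrix.mulVecLin_apply, hinr] at hv
  refine Nat.card_congr ((Equiv.addRight v).subtypeEquiv fun u => ?_)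
  have : Y *ᵥ Sum.elim x' (u + v) = Y *ᵥ Sum.elim x u := by
    have e1 : (Sum.elim x' (u + v) : m ⊕ k → F) =
        Sum.elim x u - Sum.elim (x - x') (0 : k → F) + Sum.elim (0 : m → F) v := by
      funext i; rcases i with i | i <;> simp
    rw [e1, Matrix.mulVec_add, Matrix.mulVec_sub, hv, sub_add_cancel]
  simp only [Equiv.coe_addRight, this]

/-! ### Network codes as coding on the digraph of symbols -/

namespace Network

variable {V E : Type*} [Fintype E] {R k : ℕ}

/-- The symbol of `q` is available at the node `u`. -/
def Available (G : Network V E) (u : V) : E ⊕ Fin R ⊕ Fin k → Prop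
  | .inl e => G.head e = u
  | .inr (.inl _) => u = G.S
  | .inr (.inr _) => u = G.K

open Classical in
/-- The dependencies between the symbols on edges, message symbols and key symbols. -/
noncomputable def codeDigraph (G : Network V E) (hG : G.IsAcyclic) (R k : ℕ) :
    RankedDigraph (E ⊕ Fin R ⊕ Fin k) where
  pred
    | .inl e => {q | G.Available (G.tail e) q}
    | .inr _ => ∅
  height
    -- The number of ancestor edges grows strictly along edges; the 1 puts every edge above the
    -- message and key symbols.
    | .inl e => 1 + {e' | Relation.TransGen (fun e' e => G.head e' = G.tail e) e' e}.ncard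
    | .inr _ => 0
  height_lt := by
    rintro (e | p) (e' | q) h
    · have h : G.head e' = G.tail e := (Finset.mem_filter.1 h).2
      refine Nat.add_lt_add_left (Set.ncard_lt_ncard ⟨fun a ha => ha.tail h, fun hsub => ?_⟩) 1
      exact hG.wellFounded.transGen.irrefl.irrefl e' (hsub (.single h))
    · positivity
    · simp at h
    · simp at h

variable (G : Network V E) (hG : G.IsAcyclic)

theorem mem_pred_codeDigraph {e : E} {q : E ⊕ Fin R ⊕ Fin k} :
    q ∈ (G.codeDigraph hG R k).pred (.inl e) ↔ G.Available (G.tail e) q := by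
  simp [codeDigraph]

theorem pred_codeDigraph_inr (j : Fin R ⊕ Fin k) :
    (G.codeDigraph hG R k).pred (.inr j) = ∅ := rfl

/-- Coefficients of a linear code, as coefficients on the digraph of dependencies. -/
def LinearEncoding.coeff {A : Type*} [Zero A] (c : LinearEncoding E A R k) :
    E ⊕ Fin R ⊕ Fin k → E ⊕ Fin R ⊕ Fin k → A
  | .inl e => c e
  | .inr _ => 0

section

variable [DecidableEq E] {F : Type*} [Field F]

theorem edgeMessage_toEncoding [DecidableEq V] (c : LinearEncoding E F R k) (e : E)
    (ω : (Fin R → F) × (Fin k → F)) :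
    G.edgeMessage hG (c.toEncoding G) e ω =
      ∑ j, (G.codeDigraph hG R k).sourceVec Sum.inr c.coeff (.inl e) j *
        (Sum.elim ω.1 ω.2 j : F) := by
  induction e using hG.wellFounded.induction with
  | _ e ih =>
  have hinj : Function.Injective (Sum.inr : Fin R ⊕ Fin k → E ⊕ Fin R ⊕ Fin k) :=
    Sum.inr_injective
  have hpred : ∀ g : E ⊕ Fin R ⊕ Fin k → F, ∑ q ∈ (G.codeDigraph hG R k).pred (.inl e), g q =
      ∑ e' : G.In (G.tail e), g (.inl e'.1) +
        (if G.tail e = G.S then ∑ j, g (.inr (.inl j)) else 0) +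
        (if G.tail e = G.K then ∑ j, g (.inr (.inr j)) else 0) := by
    intro g
    simp only [codeDigraph]
    rw [Finset.sum_filter, Fintype.sum_sum_type, Fintype.sum_sum_type, ← add_assoc]
    congr 1
    · congr 1
      · rw [← Finset.sum_filter]
        exact Finset.sum_subtype _ (fun e' => by simp only [Finset.mem_filter_univ]; rfl) _
      · by_cases h : G.tail e = G.S
        · rw [if_pos h]
          exact Finset.sum_congr rfl fun _ _ => if_pos h
        · rw [if_neg h]
          exact Finset.sum_eq_zero fun _ _ => if_neg h
    · by_cases h : G.tail e = G.K
      · rw [if_pos h]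
        exact Finset.sum_congr rfl fun _ _ => if_pos h
      · rw [if_neg h]
        exact Finset.sum_eq_zero fun _ _ => if_neg h
  rw [edgeMessage_eq, RankedDigraph.sourceVec_of_not_source _ (by simp), LinearEncoding.toEncoding]
  simp only [Finset.sum_apply, Pi.smul_apply, smul_eq_mul, Finset.sum_mul]
  rw [Finset.sum_comm, hpred]
  have hsrc : ∀ j, (G.codeDigraph hG R k).sourceVec Sum.inr c.coeff (.inr j) = Pi.single j 1 :=
    RankedDigraph.sourceVec_source _ hinj (G.pred_codeDigraph_inr hG) c.coeff
  congr 1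
  · congr 1
    · refine Finset.sum_congr rfl fun e' _ => ?_
      rw [ih e'.1 e'.2, Finset.mul_sum]
      exact Finset.sum_congr rfl fun j _ => (mul_assoc _ _ _).symm
    · simp only [hsrc, LinearEncoding.coeff, dite_eq_ite]
      split_ifs
      · refine Finset.sum_congr rfl fun j _ => ?_
        simp [Pi.single_apply]
      · rfl
  · simp only [hsrc, LinearEncoding.coeff, dite_eq_ite]
    split_ifs
    · refine Finset.sum_congr rfl fun j _ => ?_
      simp [Pi.single_apply]
    · rfl

end

section Generic

variable [DecidableEq E]

/-- The symbols `ρ i` as linear combinations of the source symbols `src j`. -/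
noncomputable def transferMatrix {m J A : Type*} [CommRing A] (src : J → E ⊕ Fin R ⊕ Fin k)
    (ρ : m → E ⊕ Fin R ⊕ Fin k) (c : LinearEncoding E A R k) : Matrix m J A :=
  Matrix.of fun i => (G.codeDigraph hG R k).sourceVec src c.coeff (ρ i)

theorem map_transferMatrix {m J A B : Type*} [CommRing A] [CommRing B] (φ : A →+* B)
    (src : J → E ⊕ Fin R ⊕ Fin k) (ρ : m → E ⊕ Fin R ⊕ Fin k) (c : LinearEncoding E A R k) :
    (G.transferMatrix hG src ρ c).map φ =
      G.transferMatrix hG src ρ (fun e q => φ (c e q)) := by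
  ext i j
  simp only [transferMatrix, RankedDigraph.sourceVec, Matrix.map_apply, Matrix.of_apply,
    RankedDigraph.map_transfer]
  congr 1
  funext p q
  rcases p with e | p <;> simp [LinearEncoding.coeff]

theorem rank_transferMatrix {m J F : Type*} [Field F] [Fintype m] [Fintype J]
    (src : J → E ⊕ Fin R ⊕ Fin k) (ρ : m → E ⊕ Fin R ⊕ Fin k) (c : LinearEncoding E F R k) :
    (G.transferMatrix hG src ρ c).rank = Module.finrank F (Submodule.span F
      ((G.codeDigraph hG R k).sourceVec src c.coeff '' (Finset.univ.image ρ : Finset _))) := by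
  rw [Matrix.rank_eq_finrank_span_row, Finset.coe_image, Finset.coe_univ, Set.image_univ,
    ← Set.range_comp]
  rfl

/-- The minors are polynomials over `ℤ` in the coefficients, and there are finitely many, which
bounds their degrees for all fields at once. Over each field the Menger-type bound supplies a point
where one of them is nonzero; which one may depend on the field. -/
theorem holdsGenerically_le_rank_transferMatrix {m J : Type*} [Fintype m] [Fintype J]
    {src : J → E ⊕ Fin R ⊕ Fin k} (hinj : Function.Injective src)
    (hsrc : ∀ j, (G.codeDigraph hG R k).pred (src j) = ∅) (ρ : m → E ⊕ Fin R ⊕ Fin k) (r : ℕ)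
    (h : ∀ U, (∀ i, ρ i ∈ U) → r ≤ ((G.codeDigraph hG R k).boundary src U).card) :
    HoldsGenerically fun F _ (x : E × (E ⊕ Fin R ⊕ Fin k) → F) =>
      r ≤ (G.transferMatrix hG src ρ (Function.curry x)).rank := by
  classical
  let X : LinearEncoding E (MvPolynomial (E × (E ⊕ Fin R ⊕ Fin k)) ℤ) R k :=
    fun e q => .X (e, q)
  let D : (Fin r → m) × (Fin r → J) → MvPolynomial (E × (E ⊕ Fin R ⊕ Fin k)) ℤ :=
    fun fg => ((G.transferMatrix hG src ρ X).submatrix fg.1 fg.2).det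
  obtain ⟨d, hd⟩ := Finite.exists_le fun fg => (D fg).totalDegree
  have heval : ∀ (F : Type) [Field F] (x : E × (E ⊕ Fin R ⊕ Fin k) → F) fg,
      MvPolynomial.eval x (MvPolynomial.map (Int.castRingHom F) (D fg)) =
        ((G.transferMatrix hG src ρ (Function.curry x)).submatrix fg.1 fg.2).det := by
    intro F _ x fg
    rw [MvPolynomial.eval_map, ← MvPolynomial.coe_eval₂Hom, RingHom.map_det,
      RingHom.mapMatrix_apply, ← Matrix.submatrix_map, map_transferMatrix]
    simp [X]
    rfl
  refine ⟨d, fun F _ => ?_⟩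
  obtain ⟨c, hc⟩ := (G.codeDigraph hG R k).exists_finrank_span_sourceVec (F := F) hinj hsrc
    (Finset.univ.image ρ) r fun U hU => h U fun i => hU (by simp)
  -- The values of `c` at message and key symbols are discarded; these vertices have no
  -- in-neighbours.
  let x : E × (E ⊕ Fin R ⊕ Fin k) → F := fun p => c (.inl p.1) p.2
  have hx : (G.codeDigraph hG R k).sourceVec src (LinearEncoding.coeff (Function.curry x)) =
      (G.codeDigraph hG R k).sourceVec src c := by
    funext p
    unfold RankedDigraph.sourceVec
    suffices (G.codeDigraph hG R k).transfer (LinearEncoding.coeff (Function.curry x)) p =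
      (G.codeDigraph hG R k).transfer c p by rw [this]
    induction p using (G.codeDigraph hG R k).height_induction with
    | h p ih =>
      rw [RankedDigraph.transfer_eq, RankedDigraph.transfer_eq]
      congr 1
      refine Finset.sum_congr rfl fun q hq => ?_
      rw [ih q hq]
      rcases p with e | p
      · rfl
      · simp [pred_codeDigraph_inr] at hq
  rw [← hx, ← rank_transferMatrix] at hc
  obtain ⟨f, g, hfg⟩ := Matrix.exists_det_submatrix_ne_zero _ hc
  refine ⟨MvPolynomial.map (Int.castRingHom F) (D (f, g)), fun h0 => ?_,
    (MvPolynomial.totalDegree_map_le _ _).trans (hd _), fun y hy => ?_⟩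
  · rw [← heval F x (f, g), h0, map_zero] at hfg
    exact hfg rfl
  · rw [heval] at hy
    exact Matrix.le_rank_of_det_submatrix_ne_zero _ hy

end Generic

/-! ### From network cuts to boundaries of symbol sets -/

section Cuts

variable {G hG} [DecidableEq E] {J : Type*} {src : J → E ⊕ Fin R ⊕ Fin k}
  {U : Finset (E ⊕ Fin R ⊕ Fin k)}

/-- The edges in the boundary of a set of symbols. -/
noncomputable def boundaryEdges (G : Network V E) (hG : G.IsAcyclic)
    (src : J → E ⊕ Fin R ⊕ Fin k) (U : Finset (E ⊕ Fin R ⊕ Fin k)) : Finset E :=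
  {e | .inl e ∈ (G.codeDigraph hG R k).boundary src U}

/-- An edge of `U` outside the boundary has all its inputs in `U`, so walking back from `t` along
such edges never leaves `U`. A missing source symbol therefore makes the boundary edges a cut. -/
theorem mem_of_available_of_reach {t v : V} (ht : ∀ q, G.Available t q → q ∈ U)
    (hv : Relation.ReflTransGen (G.StepAvoiding (G.boundaryEdges hG src U)) v t)
    (q : E ⊕ Fin R ⊕ Fin k) (hq : G.Available v q) : q ∈ U := by
  induction hv using Relation.ReflTransGen.head_induction_on generalizing q with
  | refl => exact ht q hq
  | head h _ ih =>
    obtain ⟨e, he, rfl, rfl⟩ := h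
    have heU : Sum.inl e ∈ U := ih (.inl e) rfl
    simp only [boundaryEdges, Finset.mem_filter_univ, RankedDigraph.mem_boundary, heU, true_and,
      not_or, not_not] at he
    exact he.2 ((G.mem_pred_codeDigraph hG).2 hq)

theorem not_reach_of_notMem {t v : V} (ht : ∀ q, G.Available t q → q ∈ U)
    {q : E ⊕ Fin R ⊕ Fin k} (hq : G.Available v q) (hqU : q ∉ U) :
    ¬ Relation.ReflTransGen (G.StepAvoiding (G.boundaryEdges hG src U)) v t :=
  fun h => hqU (mem_of_available_of_reach ht h q hq)

theorem card_boundaryEdges_le :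
    (G.boundaryEdges hG src U).card ≤ ((G.codeDigraph hG R k).boundary src U).card :=
  Finset.card_le_card_of_injOn Sum.inl (fun e he => by simpa [boundaryEdges] using he)
    Sum.inl_injective.injOn

/-- The number of symbols separating all message and key symbols from the terminal. -/
theorem CutBounds.le_card_boundary {z : ℕ} (h : G.CutBounds R z) (hKT : G.K ≠ G.T)
    (hST : G.S ≠ G.T) {U : Finset (E ⊕ Fin R ⊕ Fin z)} (hU : ∀ e, G.head e = G.T → .inl e ∈ U) :
    R + z ≤ ((G.codeDigraph hG R z).boundary Sum.inr U).card := by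
  classical
  have ht : ∀ q : E ⊕ Fin R ⊕ Fin z, G.Available G.T q → q ∈ U := by
    rintro (e | i | j) hq
    · exact hU e hq
    · exact absurd hq.symm hST
    · exact absurd hq.symm hKT
  set C := G.boundaryEdges hG Sum.inr U
  let M : Finset (Fin R) := {i | .inr (.inl i) ∈ U}
  let N : Finset (Fin z) := {j | .inr (.inr j) ∈ U}
  have hsub : C.disjSum (M.disjSum N) ⊆ (G.codeDigraph hG R z).boundary Sum.inr U := by
    rintro (e | i | j) hq
    · simpa [C, boundaryEdges] using hq
    · exact RankedDigraph.mem_boundary.2 ⟨by simpa [M] using hq, .inl ⟨_, rfl⟩⟩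
    · exact RankedDigraph.mem_boundary.2 ⟨by simpa [N] using hq, .inl ⟨_, rfl⟩⟩
  have hcard := Finset.card_le_card hsub
  rw [Finset.card_disjSum, Finset.card_disjSum] at hcard
  obtain ⟨h1, h2, h3⟩ := h
  have hM : (∀ i, i ∈ M) → M.card = R := fun h => by
    rw [Finset.eq_univ_of_forall h, Finset.card_univ, Fintype.card_fin]
  have hN : (∀ j, j ∈ N) → N.card = z := fun h => by
    rw [Finset.eq_univ_of_forall h, Finset.card_univ, Fintype.card_fin]
  have hSr : ∀ i, i ∉ M → ¬ Relation.ReflTransGen (G.StepAvoiding C) G.S G.T := fun i hi =>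
    not_reach_of_notMem ht (q := .inr (.inl i)) rfl (by simpa [M] using hi)
  have hKr : ∀ j, j ∉ N → ¬ Relation.ReflTransGen (G.StepAvoiding C) G.K G.T := fun j hj =>
    not_reach_of_notMem ht (q := .inr (.inr j)) rfl (by simpa [N] using hj)
  -- If all message symbols (or all key symbols) are in `U`, they contribute `R` (or `z`) to the
  -- boundary. If one is missing, the boundary edges cut its node off from `T`. Each of the four
  -- cases uses the bound for the nodes cut off.
  by_cases hMa : ∀ i, i ∈ M <;> by_cases hNa : ∀ j, j ∈ N
  · have := hM hMa; have := hN hNa; omega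
  · push Not at hNa
    obtain ⟨j, hj⟩ := hNa
    have := hM hMa
    have := G.mincut_le (A := {G.K}) (t := G.T) (C := C) fun s hs => hs ▸ hKr j hj
    have := h1.trans (min_le_right _ _)
    omega
  · push Not at hMa
    obtain ⟨i, hi⟩ := hMa
    have := hN hNa
    have := G.mincut_le (A := {G.S}) (t := G.T) (C := C) fun s hs => hs ▸ hSr i hi
    omega
  · push Not at hMa hNa
    obtain ⟨i, hi⟩ := hMa
    obtain ⟨j, hj⟩ := hNa
    have := G.mincut_le (A := {G.K, G.S}) (t := G.T) (C := C) fun s hs => by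
      rcases hs with rfl | rfl
      exacts [hKr j hj, hSr i hi]
    omega

/-- Either all `z` key symbols lie in `U`, hence in its boundary, or the boundary edges cut `K` from
`S`. -/
theorem le_card_boundary_of_pred_subset {z : ℕ} (hz : z ≤ G.mincut {G.K} G.S)
    {U : Finset (E ⊕ Fin R ⊕ Fin z)} (hU : ∀ q, G.Available G.S q → q ∈ U) :
    z ≤ ((G.codeDigraph hG R z).boundary (Sum.inr ∘ Sum.inr : Fin z → _) U).card := by
  by_cases hk : ∀ j : Fin z, .inr (.inr j) ∈ U
  · have := Finset.card_le_card_of_injOn (s := Finset.univ)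
      (t := (G.codeDigraph hG R z).boundary (Sum.inr ∘ Sum.inr : Fin z → _) U)
      (fun j : Fin z => .inr (.inr j))
      (fun j _ => RankedDigraph.mem_boundary.2 ⟨hk j, .inl ⟨j, rfl⟩⟩)
      (fun i _ j _ h => by simpa using h)
    simpa using this
  · push Not at hk
    obtain ⟨j, hj⟩ := hk
    refine hz.trans ((G.mincut_le fun s hs => ?_).trans
      (card_boundaryEdges_le (hG := hG) (src := (Sum.inr ∘ Sum.inr : Fin z → _)) (U := U)))
    exact not_reach_of_notMem hU (q := .inr (.inr j)) hs hj

end Cuts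

end Network

/-! ### Rank conditions, feasibility and random codes -/

open Matrix in
theorem Matrix.exists_left_inverse_of_card_le_rank {m n F : Type*} [Fintype m] [Fintype n]
    [DecidableEq m] [DecidableEq n] [Field F] (Y : Matrix m n F) (hY : Fintype.card n ≤ Y.rank) :
    ∃ D : Matrix n m F, ∀ v, D *ᵥ (Y *ᵥ v) = v := by
  have hker : LinearMap.ker Y.mulVecLin = ⊥ := by
    have h := LinearMap.finrank_range_add_finrank_ker Y.mulVecLin
    rw [Module.finrank_fintype_fun_eq_card] at h
    change Y.rank + _ = _ at h
    exact Submodule.finrank_eq_zero.1 (by omega)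
  obtain ⟨g, hg⟩ := LinearMap.exists_leftInverse_of_injective _ hker
  refine ⟨LinearMap.toMatrix' g, fun v => ?_⟩
  rw [LinearMap.toMatrix'_mulVec]
  exact LinearMap.congr_fun hg v

namespace Network

variable {V E : Type*} [Fintype E] [DecidableEq V] [DecidableEq E] {R z : ℕ} {G : Network V E}
  {hG : G.IsAcyclic}

/-- The rank conditions under which the terminal can decode all message and key symbols, and under
which every set of at most `z` edges carries as many dimensions of the key as in total. -/
def RankConditions (G : Network V E) (hG : G.IsAcyclic) {F : Type*} [Field F]
    (c : LinearEncoding E F R z) : Prop :=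
  R + z ≤ (G.transferMatrix hG Sum.inr (fun e : G.In G.T => .inl e.1) c).rank ∧
  ∀ W : {W : Finset E // W.card ≤ z},
    (G.transferMatrix hG Sum.inr (fun e : {e // e ∈ W.1} => .inl e.1) c).rank ≤
      (G.transferMatrix hG (Sum.inr ∘ Sum.inr) (fun e : {e // e ∈ W.1} => .inl e.1) c).rank

omit [DecidableEq V] in
theorem exists_card_boundary_minimal {W : Type*} (ρ : W → E ⊕ Fin R ⊕ Fin z) {J : Type*}
    (src : J → E ⊕ Fin R ⊕ Fin z) :
    ∃ U, (∀ i, ρ i ∈ U) ∧ ∀ U', (∀ i, ρ i ∈ U') →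
      ((G.codeDigraph hG R z).boundary src U).card ≤
        ((G.codeDigraph hG R z).boundary src U').card := by
  classical
  obtain ⟨U, hU, hmin⟩ := ({U | ∀ i, ρ i ∈ U} : Finset (Finset _)).exists_min_image
    (fun U => ((G.codeDigraph hG R z).boundary src U).card) ⟨Finset.univ, by simp⟩
  exact ⟨U, by simpa using hU, fun U' hU' => hmin U' (by simpa using hU')⟩

-- The bound is trivial unless the key boundary `B` has fewer than `W.card ≤ z` elements. In that
-- case no edge of `U` outside `B` leaves `S`, since its inputs would force `z` boundary elements.
-- So without its message symbols `U` is still closed under in-neighbours outside `B`, and the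
-- symbols on `W`, message part included, are combinations of those in `B`.
omit [DecidableEq V] in
theorem rank_transferMatrix_le_card_boundary (hz : z ≤ G.mincut {G.K} G.S)
    {F : Type*} [Field F] (c : LinearEncoding E F R z) {W : Finset E} (hW : W.card ≤ z)
    {U : Finset (E ⊕ Fin R ⊕ Fin z)} (hU : ∀ e ∈ W, .inl e ∈ U) :
    (G.transferMatrix hG Sum.inr (fun e : {e // e ∈ W} => .inl e.1) c).rank ≤
      ((G.codeDigraph hG R z).boundary (Sum.inr ∘ Sum.inr : Fin z → _) U).card := by
  set B := (G.codeDigraph hG R z).boundary (Sum.inr ∘ Sum.inr : Fin z → _) U with hB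
  by_cases hWB : W.card ≤ B.card
  · exact (Matrix.rank_le_card_height _).trans (by rwa [Fintype.card_coe])
  push Not at hWB
  let N : Finset (E ⊕ Fin R ⊕ Fin z) := {p ∈ U | ∀ i, p ≠ .inr (.inl i)}
  have hN : ∀ p ∈ N, p ∉ B →
      (∀ j, Sum.inr j ≠ p) ∧ (G.codeDigraph hG R z).pred p ⊆ N := by
    intro p hp hpB
    obtain ⟨hpU, hpM⟩ := Finset.mem_filter.1 hp
    rw [hB, RankedDigraph.mem_boundary, not_and, not_or, not_not] at hpB
    obtain ⟨hpK, hpred⟩ := hpB hpU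
    rcases p with e | i | j
    · refine ⟨by simp, fun q hq => Finset.mem_filter.2 ⟨hpred hq, ?_⟩⟩
      rintro i rfl
      have hS : G.tail e = G.S := (G.mem_pred_codeDigraph hG).1 hq
      have := le_card_boundary_of_pred_subset (hG := hG) hz (U := U) fun q hq =>
        hpred ((G.mem_pred_codeDigraph hG).2 (hS ▸ hq))
      exact absurd (this.trans_lt (hWB.trans_le hW)) (lt_irrefl z)
    · exact absurd rfl (hpM i)
    · exact absurd ⟨j, rfl⟩ hpK
  rw [rank_transferMatrix]
  calc _ ≤ Module.finrank F (Submodule.span F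
        ((G.codeDigraph hG R z).sourceVec Sum.inr c.coeff '' B)) := by
        refine Submodule.finrank_mono (Submodule.span_le.2 ?_)
        rintro _ ⟨p, hp, rfl⟩
        rw [Finset.coe_image, Finset.coe_univ, Set.image_univ] at hp
        obtain ⟨e, rfl⟩ := hp
        exact RankedDigraph.sourceVec_mem_span _ hN _ _
          (Finset.mem_filter.2 ⟨hU e.1 e.2, by simp⟩)
    _ ≤ B.card := by
        classical
        rw [← Finset.coe_image]
        exact (finrank_span_finset_le_card _).trans Finset.card_image_le

theorem CutBounds.holdsGenerically_rankConditions (h : G.CutBounds R z)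
    (hKT : G.K ≠ G.T) (hST : G.S ≠ G.T) :
    HoldsGenerically fun F _ (x : E × (E ⊕ Fin R ⊕ Fin z) → F) =>
      G.RankConditions hG (Function.curry x) := by
  refine .and (G.holdsGenerically_le_rank_transferMatrix hG Sum.inr_injective
    (G.pred_codeDigraph_inr hG) _ _ fun U hU => h.le_card_boundary hKT hST
      fun e he => hU ⟨e, he⟩) (.forall_finite fun W => ?_)
  -- The least key boundary bounds the generic rank of the key part from below and the total rank
  -- from above.
  obtain ⟨U, hU, hmin⟩ := exists_card_boundary_minimal (hG := hG)
    (fun e : {e // e ∈ W.1} => (.inl e.1 : E ⊕ Fin R ⊕ Fin z)) (Sum.inr ∘ Sum.inr : Fin z → _)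
  refine (G.holdsGenerically_le_rank_transferMatrix hG (src := Sum.inr ∘ Sum.inr)
    (Sum.inr_injective.comp Sum.inr_injective) (fun j => G.pred_codeDigraph_inr hG (.inr j))
    _ _ hmin).mono fun F _ x hx => ?_
  exact (rank_transferMatrix_le_card_boundary (h.1.trans (min_le_left _ _)) _ W.2
    fun e he => hU ⟨e, he⟩).trans hx

theorem edgeMessage_eq_mulVec {F : Type*} [Field F] (c : LinearEncoding E F R z) {m : Type*}
    (ρ : m → E) (ω : (Fin R → F) × (Fin z → F)) :
    (fun i => G.edgeMessage hG (c.toEncoding G) (ρ i) ω) =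
      (G.transferMatrix hG Sum.inr (fun i => .inl (ρ i)) c).mulVec (Sum.elim ω.1 ω.2) := by
  funext i
  rw [edgeMessage_toEncoding]
  rfl

theorem RankConditions.linearFeasible {F : Type*} [Field F] [Fintype F]
    {c : LinearEncoding E F R z} (h : G.RankConditions hG c) : G.LinearFeasible hG z c := by
  refine ⟨?_, fun W hW => ?_⟩
  · obtain ⟨D, hD⟩ := Matrix.exists_left_inverse_of_card_le_rank _
      (show Fintype.card (Fin R ⊕ Fin z) ≤ _ by simpa using h.1)
    refine ⟨D.submatrix Sum.inl id, fun ω => ?_⟩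
    rw [edgeMessage_eq_mulVec c (fun e : G.In G.T => e.1)]
    funext i
    exact congrFun (hD (Sum.elim ω.1 ω.2)) (.inl i)
  · have h' := mutualInfo_fst_mulVec_eq_zero _ (h.2 ⟨W, hW⟩)
    rw [← h']
    congr 1
    funext ω
    exact edgeMessage_eq_mulVec c (fun e : {e // e ∈ W} => e.1) ω

theorem CutBounds.exists_probability_bound (h : G.CutBounds R z) (hG : G.IsAcyclic)
    (hKT : G.K ≠ G.T) (hST : G.S ≠ G.T) :
    ∃ C : ℝ, ∀ (F : Type) [Field F] [Fintype F],
      1 - C / (Fintype.card F : ℝ) ≤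
        (Nat.card {c : LinearEncoding E F R z // G.LinearFeasible hG z c} : ℝ) /
          (Nat.card (LinearEncoding E F R z) : ℝ) := by
  obtain ⟨C, hC⟩ :=
    (h.holdsGenerically_rankConditions (hG := hG) hKT hST).exists_probability_bound
  refine ⟨C, fun F _ _ => (hC F).trans ?_⟩
  have hcard : Nat.card (E × (E ⊕ Fin R ⊕ Fin z) → F) = Nat.card (LinearEncoding E F R z) :=
    Nat.card_congr (Equiv.curry _ _ _)
  rw [hcard]
  gcongr
  exact Nat.card_le_card_of_injective
    (fun x : {x : E × (E ⊕ Fin R ⊕ Fin z) → F // G.RankConditions hG (Function.curry x)} =>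
      (⟨Function.curry x.1, x.2.linearFeasible⟩ :
        {c : LinearEncoding E F R z // G.LinearFeasible hG z c}))
    fun x y hxy => Subtype.ext ((Equiv.curry _ _ _).injective (Subtype.ext_iff.1 hxy))

theorem CutBounds.exists_linearFeasible (h : G.CutBounds R z) (hG : G.IsAcyclic)
    (hKT : G.K ≠ G.T) (hST : G.S ≠ G.T) :
    ∃ (F : Type) (_ : Field F) (_ : Fintype F) (c : LinearEncoding E F R z),
      G.LinearFeasible hG z c := by
  obtain ⟨C, hC⟩ := h.exists_probability_bound hG hKT hST
  obtain ⟨n, hn⟩ := exists_nat_gt C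
  obtain ⟨p, hnp, hp⟩ := Nat.exists_infinite_primes n
  have : Fact p.Prime := ⟨hp⟩
  have hp0 : (0 : ℝ) < p := by exact_mod_cast hp.pos
  have hCp : C / p < 1 := (div_lt_one hp0).2 (hn.trans_le (by exact_mod_cast hnp))
  have h1 := hC (ZMod p)
  rw [ZMod.card] at h1
  by_contra! hcon
  have : IsEmpty {c : LinearEncoding E (ZMod p) R z // G.LinearFeasible hG z c} :=
    ⟨fun c => hcon (ZMod p) inferInstance inferInstance c.1 c.2⟩
  rw [Nat.card_of_isEmpty, Nat.cast_zero, zero_div] at h1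
  linarith

theorem LinearFeasible.feasible {F : Type*} [Field F] [Fintype F] {k : ℕ}
    {c : LinearEncoding E F R k} (h : G.LinearFeasible hG z c) :
    G.Feasible hG R z (c.toEncoding G) := by
  obtain ⟨⟨D, hD⟩, hsec⟩ := h
  exact ⟨⟨D.mulVec, hD⟩, hsec⟩

end Network

theorem theorem1 {V E : Type*} [Finite V] [Fintype E] [DecidableEq V] [DecidableEq E]
    (G : Network V E) (hKS : G.K ≠ G.S) (hKT : G.K ≠ G.T) (hST : G.S ≠ G.T)
    (R z : ℕ) (hR : 0 < R) :
    (∀ hG : G.IsAcyclic,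
      -- scalar linear codes over a finite field
      ((∃ (F : Type) (_ : Field F) (_ : Fintype F) (k : ℕ) (c : Network.LinearEncoding E F R k),
          G.LinearFeasible hG z c) ↔ G.CutBounds R z) ∧
      -- arbitrary codes over a finite alphabet
      ((∃ (A Key : Type) (_ : Fintype A) (_ : Nontrivial A) (_ : Fintype Key) (_ : Nonempty Key)
          (f : G.Encoding (Fin R → A) Key A), G.Feasible hG R z f) ↔ G.CutBounds R z) ∧
      -- random scalar linear codes with `z` key symbols over large fields
      (G.CutBounds R z → ∃ C : ℝ, ∀ (F : Type) [Field F] [Fintype F],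
        1 - C / (Fintype.card F : ℝ) ≤
          (Nat.card {c : Network.LinearEncoding E F R z // G.LinearFeasible hG z c} : ℝ) /
            (Nat.card (Network.LinearEncoding E F R z) : ℝ))) ∧
    -- converse for time-indexed codes, without acyclicity
    (∀ (n : ℕ) (A Key : Type) [Fintype A] [Nontrivial A] [Fintype Key] [Nonempty Key]
      (f : G.TimedEncoding n (Fin (n * R) → A) Key A),
      0 < n → G.TimedFeasible R z f → G.CutBounds R z) := by

  refine ⟨fun hG => ⟨⟨?_, fun h => ?_⟩, ⟨?_, fun h => ?_⟩, fun h => ?_⟩, ?_⟩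
  · rintro ⟨F, _, _, k, c, hc⟩
    exact hc.feasible.cutBounds hKS hKT hST hR
  · obtain ⟨F, hF, hF', c, hc⟩ := h.exists_linearFeasible hG hKT hST
    exact ⟨F, hF, hF', z, c, hc⟩
  · rintro ⟨A, Key, _, _, _, _, f, hf⟩
    exact hf.cutBounds hKS hKT hST hR
  · obtain ⟨F, hF, hF', c, hc⟩ := h.exists_linearFeasible hG hKT hST
    exact ⟨F, Fin z → F, hF', inferInstance, inferInstance, inferInstance, c.toEncoding G,
      hc.feasible⟩
  · exact h.exists_probability_bound hG hKT hST
  · intro n A Key _ _ _ _ f hn hf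
    exact hf.cutBounds hKS hKT hST hR hn
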